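/- **Setting.** For $1\le p\le\infty$ let $\|\cdot\|_p$ be the $p$-norm on $\mathbb{R}^d$ and $B_q(x,r)=\{y:\|y-x\|_q\le r\}$. Let $f:\mathbb{R}^d\to\mathbb{R}$ be bounded below, $f^*=\inf f>-\infty$, and well-behaved: $f$ is differentiable and for all $x,x'\in\mathbb{R}^d$ the function $r\mapsto\langle\nabla f(x+r(x'-x)),x'-x\rangle$ is integrable on $[0,1]$ with integral $f(x')-f(x)$. For $\delta>0$ put $$\|\nabla f(x)\|_{1,\infty}^{[\delta]}:=\inf\Big\{\Big\|\frac1{|S|}\sum_{y\in S}\nabla f(y)\Big\|_1:\ S\subseteq B_\infty(x,\delta)\text{ finite, nonempty},\ \frac1{|S|}\sum_{y\in S}y=x\Big\};$$ $x$ is a $(\delta,\epsilon)$-$\ell_{1,\infty}$-Goldstein stationary point if this quantity is at most $\epsilon$. **Algorithm.** Input: $x_0\in\mathbb{R}^d$, $K,N\ge 1$, $D_\infty>0$, $\Delta_0\in B_\infty(0,D_\infty)$, $G_0=0$; put $T=KN$, $\eta_0=0$. For $t=1,\dots,T$: 1. $\Delta_t=\Pi\big[\Delta_{t-1}-\eta_{t-1}\,\mathrm{sgn}(g_{t-1}+G_{t-1}\odot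 n_{t-1})\big]$, where $n_{t-1}$ is uniform on $[-1,1]^d$ and independent of all previous random variables, $\mathrm{sgn}$ acts coordinate-wise, and $\Pi$ is the $G_{t-1}$-weighted projection onto $B_\infty(0,D_\infty)$ in its coordinate-wise form, that is, every coordinate is clipped to $[-D_\infty,D_\infty]$ (for $t=1$ the subtracted term is $0$); 2. $x_t=x_{t-1}+\Delta_t$ and $w_t=x_{t-1}+s_t\Delta_t$, where $s_t$ is uniform on $[0,1]$ and independent of all previous random variables; 3. one stochastic gradient $g_t$ is queried, with conditional expectation $\nabla f(w_t)$ given all previous random variables (including $s_t$); 4. $G_t=\max\{G_{t-1},|g_t|\}$ coordinate-wise. Output: $\overline w=\overline w^{\kappa}$, where $\overline w^k=\frac1N\sum_{j=1}^N w_{(k-1)N+j}$ and $\kappa$ is uniform on $\{1,\dots,K\}$ and independent of everything above. **Theorem.** Let $\epsilon,\delta,\Delta_f>0$, $f(x_0)-f^*\le\Delta_f$, and let $L\in\mathbb{R}^d_{\ge0}$ with $\|L\|_1>0$. Set $$K=\Big\lceil\frac{3\Delta_f}{\epsilon\delta}\Big\rceil,\quad N=\Big\lceil\frac{81\|L\|_1^2}{4\epsilon^2}\Big\rceil,\quad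 D_\infty=\frac{\delta}{N},\quad \eta_t=\frac{2D_\infty}{\sqrt N}\ (t\ge1),$$ and assume that $\mathbb{E}\big[\max_{1\le t\le T}|g_{t,i}|^2\big]\le L_i^2$ for every coordinate $i$. Then the algorithm, which uses exactly $T=KN$ stochastic gradients, finds a $(\delta,\epsilon)$-$\ell_{1,\infty}$-Goldstein stationary point in expectation: $$\mathbb{E}\Big[\|\nabla f(\overline w)\|_{1,\infty}^{[\delta]}\Big]\le\epsilon .$$ (The expectation is read as an outer expectation, so that no measurability of the infimum has to be presupposed: the integrand has measurable majorants whose expectations have infimum at most $\epsilon$.) If moreover $\frac{3\Delta_f}{\epsilon\delta}\ge\frac12$ and $\frac{81\|L\|_1^2}{4\epsilon^2}\ge\frac12$, then $$T=KN\le 1323\,\Delta_f\,\|L\|_1^2\,\delta^{-1}\epsilon^{-3}.$$ -/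

import Mathlib

open MeasureTheory ProbabilityTheory
open scoped ENNReal

namespace StoSign

/-- The `p`-norm of a vector of `ℝ^d`. -/
noncomputable def lpNorm {d : ℕ} (p : ℝ≥0∞) (v : Fin d → ℝ) : ℝ :=
  ‖(WithLp.toLp p v : PiLp p (fun _ : Fin d => ℝ))‖

/-- The closed `q`-norm ball `B_q(x, r)`. -/
def lpBall {d : ℕ} (q : ℝ≥0∞) (x : EuclideanSpace ℝ (Fin d)) (r : ℝ) :
    Set (EuclideanSpace ℝ (Fin d)) :=
  {y | lpNorm q (fun i => y i - x i) ≤ r}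

/-- The Goldstein measure of stationarity: the infimum, over all nonempty finite sets `S` in the
closed `q`-norm ball of radius `δ` around `x` whose points average to `x`, of the `p`-norm of the
average gradient over `S`. (The set `S = {x}` is always admissible if `0 ≤ δ`.) -/
noncomputable def goldsteinMeasure {d : ℕ} (p q : ℝ≥0∞) (f : EuclideanSpace ℝ (Fin d) → ℝ)
    (δ : ℝ) (x : EuclideanSpace ℝ (Fin d)) : ℝ :=
  sInf {v : ℝ | ∃ S : Finset (EuclideanSpace ℝ (Fin d)), S.Nonempty ∧
    (∀ y ∈ S, y ∈ lpBall q x δ) ∧ (S.card : ℝ)⁻¹ • ∑ y ∈ S, y = x ∧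
    v = lpNorm p (fun i => ((S.card : ℝ)⁻¹ • ∑ y ∈ S, gradient f y) i)}

/-- Outer expectation: the infimum of the expectations of the measurable majorants. It agrees with
the expectation for measurable functions, and is never smaller than the Lebesgue integral `∫⁻`. -/
noncomputable def outerExpectation {Ω : Type*} [MeasurableSpace Ω] (μ : Measure Ω)
    (F : Ω → ℝ≥0∞) : ℝ≥0∞ :=
  ⨅ (H : Ω → ℝ≥0∞) (_ : Measurable H) (_ : ∀ ω, F ω ≤ H ω), ∫⁻ ω, H ω ∂μ

/-- `f` is differentiable, and the fundamental theorem of calculus holds along segments. -/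
structure WellBehaved {d : ℕ} (f : EuclideanSpace ℝ (Fin d) → ℝ) : Prop where
  differentiable : Differentiable ℝ f
  intervalIntegrable : ∀ x x' : EuclideanSpace ℝ (Fin d),
    IntervalIntegrable (fun r : ℝ => inner ℝ (gradient f (x + r • (x' - x))) (x' - x)) volume 0 1
  ftc : ∀ x x' : EuclideanSpace ℝ (Fin d),
    f x' - f x = ∫ r in (0 : ℝ)..1, inner ℝ (gradient f (x + r • (x' - x))) (x' - x)

/-! ### The algorithm, along one realization `g 1, g 2, …` of the stochastic gradients,
`n 0, n 1, …` of the sign noise and `s 1, s 2, …` of the random scaling -/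

/-- The stochastic sign operator for the noise realization `n`. -/
noncomputable def stoSign {d : ℕ} (G : Fin d → ℝ) (x : EuclideanSpace ℝ (Fin d))
    (n : Fin d → ℝ) : EuclideanSpace ℝ (Fin d) :=
  WithLp.toLp 2 (fun i => Real.sign (x i + G i * n i))

/-- `G_0 = 0`, `G_t = max {G_{t-1}, |g_t|}` (coordinate-wise). -/
noncomputable def gradMax {d : ℕ} (g : ℕ → EuclideanSpace ℝ (Fin d)) : ℕ → Fin d → ℝ
  | 0 => 0
  | t + 1 => fun i => max (gradMax g t i) |g (t + 1) i|

/-- The squared weighted (semi)norm `‖z‖_G²`. -/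
def weightedSq {d : ℕ} (G : Fin d → ℝ) (z : EuclideanSpace ℝ (Fin d)) : ℝ :=
  ∑ i, G i * z i ^ 2

/-- The weighted projection onto the box `B_∞(0, D)`, in its coordinate-wise form: for every weight
`G ≥ 0` it is a minimizer of `‖z - y‖_G²` over the box, and the only one if all weights are
positive (`projBox_isMinOn`, `projBox_unique`). -/
noncomputable def projBox {d : ℕ} (D : ℝ) (y : EuclideanSpace ℝ (Fin d)) :
    EuclideanSpace ℝ (Fin d) :=
  WithLp.toLp 2 (fun i => max (-D) (min D (y i)))

/-- The directions: `Δ_t = Π[Δ_{t-1} - η_{t-1} S_{G_{t-1}}(g_{t-1})]`. As `η 0 = 0`, the value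
`g 0` is irrelevant. -/
noncomputable def direction {d : ℕ} (D : ℝ) (η : ℕ → ℝ) (Δ₀ : EuclideanSpace ℝ (Fin d))
    (g : ℕ → EuclideanSpace ℝ (Fin d)) (n : ℕ → Fin d → ℝ) : ℕ → EuclideanSpace ℝ (Fin d)
  | 0 => Δ₀
  | t + 1 => projBox D (direction D η Δ₀ g n t - η t • stoSign (gradMax g t) (g t) (n t))

/-- The iterates: `x_t = x_{t-1} + Δ_t`. -/
noncomputable def iterate {d : ℕ} (D : ℝ) (η : ℕ → ℝ) (x₀ Δ₀ : EuclideanSpace ℝ (Fin d))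
    (g : ℕ → EuclideanSpace ℝ (Fin d)) (n : ℕ → Fin d → ℝ) : ℕ → EuclideanSpace ℝ (Fin d)
  | 0 => x₀
  | t + 1 => iterate D η x₀ Δ₀ g n t + direction D η Δ₀ g n (t + 1)

/-- The points at which the oracle is queried: `w_t = x_{t-1} + s_t Δ_t` for `t ≥ 1` (the value at
`t = 0` is not used). -/
noncomputable def queryPoint {d : ℕ} (D : ℝ) (η : ℕ → ℝ) (x₀ Δ₀ : EuclideanSpace ℝ (Fin d))
    (g : ℕ → EuclideanSpace ℝ (Fin d)) (n : ℕ → Fin d → ℝ) (s : ℕ → ℝ) :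
    ℕ → EuclideanSpace ℝ (Fin d)
  | 0 => x₀
  | t + 1 => iterate D η x₀ Δ₀ g n t + s (t + 1) • direction D η Δ₀ g n (t + 1)

/-- The average of the `k`-th block (`k ≥ 1`) of `N` consecutive points. -/
noncomputable def blockAverage {d : ℕ} (N : ℕ) (w : ℕ → EuclideanSpace ℝ (Fin d)) (k : ℕ) :
    EuclideanSpace ℝ (Fin d) :=
  (N : ℝ)⁻¹ • ∑ j ∈ Finset.Icc 1 N, w ((k - 1) * N + j)

/-- The step sizes: `η_0 = 0` and `η_t = 2 D / √N` for `t ≥ 1`. -/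
noncomputable def stepSize (D : ℝ) (N : ℕ) (t : ℕ) : ℝ :=
  if t = 0 then 0 else 2 * D / Real.sqrt N

/-! ### The randomness -/

/-- The information in `g_1, …, g_a`, `s_1, …, s_b` and `n_0, …, n_{c-1}`. -/
abbrev history {Ω : Type*} {d : ℕ} (g : ℕ → Ω → EuclideanSpace ℝ (Fin d)) (s : ℕ → Ω → ℝ)
    (n : ℕ → Ω → Fin d → ℝ) (a b c : ℕ) : MeasurableSpace Ω :=
  (⨆ j ∈ Finset.Icc 1 a, MeasurableSpace.comap (g j) inferInstance) ⊔
  (⨆ j ∈ Finset.Icc 1 b, MeasurableSpace.comap (s j) inferInstance) ⊔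
  (⨆ j ∈ Finset.range c, MeasurableSpace.comap (n j) inferInstance)

/-- The random variables used in `T` iterations of the algorithm on `f`. In iteration `t + 1`
(for `t < T`) the sign noise `n_t` is drawn uniformly from `[-1,1]^d`, then `s_{t+1}` uniformly
from `[0,1]`, both afresh; then one stochastic gradient `g_{t+1}` is queried, which is unbiased for
`∇f(w_{t+1})` given all that happened before. -/
structure IsRun {Ω : Type*} [MeasurableSpace Ω] (μ : Measure Ω) {d : ℕ}
    (f : EuclideanSpace ℝ (Fin d) → ℝ) (D : ℝ) (η : ℕ → ℝ) (x₀ Δ₀ : EuclideanSpace ℝ (Fin d))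
    (T : ℕ) (g : ℕ → Ω → EuclideanSpace ℝ (Fin d)) (s : ℕ → Ω → ℝ)
    (n : ℕ → Ω → Fin d → ℝ) : Prop where
  measurable_g : ∀ t < T, Measurable (g (t + 1))
  measurable_s : ∀ t < T, Measurable (s (t + 1))
  measurable_n : ∀ t < T, Measurable (n t)
  noise_uniform : ∀ t < T,
    pdf.IsUniform (n t) (Set.Icc (fun _ => (-1 : ℝ)) (fun _ => (1 : ℝ))) μ volume
  noise_indep : ∀ t < T,
    Indep (MeasurableSpace.comap (n t) inferInstance) (history g s n t t t) μ
  scaling_uniform : ∀ t < T, pdf.IsUniform (s (t + 1)) (Set.Icc (0 : ℝ) 1) μ volume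
  scaling_indep : ∀ t < T,
    Indep (MeasurableSpace.comap (s (t + 1)) inferInstance) (history g s n t t (t + 1)) μ
  unbiased : ∀ t < T, ∀ i : Fin d,
    μ[fun ω => g (t + 1) ω i | history g s n t (t + 1) (t + 1)] =ᵐ[μ]
      fun ω => gradient f (queryPoint D η x₀ Δ₀ (fun j => g j ω) (fun j => n j ω)
        (fun j => s j ω) (t + 1)) i

/-- Coordinate-wise Lipschitzness of the stochastic gradients: `E ‖(g_{1,i}, …, g_{T,i})‖_∞² ≤ L_i²`
for every coordinate `i`. -/
structure CoordLipschitz {Ω : Type*} [MeasurableSpace Ω] (μ : Measure Ω) {d : ℕ} (T : ℕ)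
    (g : ℕ → Ω → EuclideanSpace ℝ (Fin d)) (L : Fin d → ℝ) : Prop where
  nonneg : ∀ i, 0 ≤ L i
  integrable : ∀ i, Integrable (fun ω => lpNorm ⊤ (fun j : Fin T => g (j + 1) ω i) ^ 2) μ
  bound : ∀ i, ∫ ω, lpNorm ⊤ (fun j : Fin T => g (j + 1) ω i) ^ 2 ∂μ ≤ L i ^ 2

/-! ### Helper facts -/

theorem outerExpectation_of_measurable {Ω : Type*} [MeasurableSpace Ω] (μ : Measure Ω)
    {F : Ω → ℝ≥0∞} (hF : Measurable F) : outerExpectation μ F = ∫⁻ ω, F ω ∂μ :=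
  le_antisymm (iInf_le_of_le F (iInf_le_of_le hF (iInf_le_of_le (fun _ => le_rfl) le_rfl)))
    (le_iInf fun _ => le_iInf fun _ => le_iInf fun h => lintegral_mono h)

theorem lpNorm_top_le_iff {d : ℕ} (v : Fin d → ℝ) {r : ℝ} (hr : 0 ≤ r) :
    lpNorm ⊤ v ≤ r ↔ ∀ i, |v i| ≤ r := by
  have h : lpNorm ⊤ v = ‖v‖ := PiLp.norm_toLp v
  rw [h, pi_norm_le_iff_of_nonneg hr]
  simp [Real.norm_eq_abs]

theorem lpNorm_one {d : ℕ} (v : Fin d → ℝ) : lpNorm 1 v = ∑ i, |v i| := by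
  simp [lpNorm, PiLp.norm_eq_of_L1]

theorem mem_box_iff {d : ℕ} {D : ℝ} (hD : 0 ≤ D) (z : EuclideanSpace ℝ (Fin d)) :
    z ∈ lpBall ⊤ 0 D ↔ ∀ i, |z i| ≤ D := by
  simp [lpBall, lpNorm_top_le_iff _ hD]

theorem projBox_mem {d : ℕ} {D : ℝ} (hD : 0 ≤ D) (y : EuclideanSpace ℝ (Fin d)) :
    projBox D y ∈ lpBall ⊤ 0 D := by
  rw [mem_box_iff hD]
  intro i
  simp only [projBox]
  rw [abs_le]
  exact ⟨le_max_left _ _, max_le (by linarith) (min_le_left _ _)⟩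

theorem clip_key {D y z : ℝ} (hD : 0 ≤ D) (hz : |z| ≤ D) :
    (max (-D) (min D y) - y) ^ 2 + (z - max (-D) (min D y)) ^ 2 ≤ (z - y) ^ 2 := by
  rw [abs_le] at hz
  rcases le_total D y with h | h
  · rw [min_eq_left h, max_eq_right (by linarith)]
    nlinarith
  · rw [min_eq_right h]
    rcases le_total (-D) y with h' | h'
    · rw [max_eq_right h']
      nlinarith
    · rw [max_eq_left h']
      nlinarith

theorem projBox_isMinOn {d : ℕ} {D : ℝ} (hD : 0 ≤ D) (y : EuclideanSpace ℝ (Fin d))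
    (G : Fin d → ℝ) (hG : ∀ i, 0 ≤ G i) :
    IsMinOn (fun z => weightedSq G (z - y)) (lpBall ⊤ 0 D) (projBox D y) := by
  intro z hz
  rw [mem_box_iff hD] at hz
  refine Finset.sum_le_sum fun i _ => mul_le_mul_of_nonneg_left ?_ (hG i)
  have := clip_key (y := y i) hD (hz i)
  simp only [projBox, PiLp.sub_apply]
  nlinarith [sq_nonneg (z i - max (-D) (min D (y i)))]

theorem projBox_unique {d : ℕ} {D : ℝ} (hD : 0 ≤ D) (y : EuclideanSpace ℝ (Fin d))
    (G : Fin d → ℝ) (hG : ∀ i, 0 < G i) (z : EuclideanSpace ℝ (Fin d))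
    (hz : z ∈ lpBall ⊤ 0 D)
    (hmin : IsMinOn (fun z => weightedSq G (z - y)) (lpBall ⊤ 0 D) z) : z = projBox D y := by
  have h1 : weightedSq G (z - y) ≤ weightedSq G (projBox D y - y) := hmin (projBox_mem hD y)
  rw [mem_box_iff hD] at hz
  have h2 : ∀ i ∈ Finset.univ, G i * (projBox D y - y) i ^ 2 ≤ G i * (z - y) i ^ 2 := by
    intro i _
    refine mul_le_mul_of_nonneg_left ?_ (hG i).le
    have := clip_key (y := y i) hD (hz i)
    simp only [projBox, PiLp.sub_apply]
    nlinarith [sq_nonneg (z i - max (-D) (min D (y i)))]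
  have h3 := (Finset.sum_eq_sum_iff_of_le h2).1 (le_antisymm (Finset.sum_le_sum h2) h1)
  ext i
  have h4 := mul_left_cancel₀ (hG i).ne' (h3 i (Finset.mem_univ i))
  have := clip_key (y := y i) hD (hz i)
  simp only [projBox, PiLp.sub_apply] at h4 ⊢
  have h5 : (z i - max (-D) (min D (y i))) ^ 2 ≤ 0 := by linarith
  have h6 := pow_eq_zero_iff (two_ne_zero) |>.1 (le_antisymm h5 (sq_nonneg _))
  linarith

end StoSign

/-!
The gradients at the points queried in one block of `N` steps are compared with the best fixed
direction `u` of the box in hindsight, for which `-⟪∑ ∇f (w_t), u⟫ = D ‖∑ ∇f (w_t)‖₁`. Coordinate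
by coordinate, three facts bound this norm.

* Regret. `signLoss`, the random sign multiplied by the running maximum `G_t`, is an unbiased
  estimate of the stochastic gradient, since `|g_t| ≤ G_t` (`integral_sign_add_mul`). The update of
  the directions is projected gradient descent for these losses with metric `G_t / η`, and as `G_t`
  is nondecreasing, the regret of a block is at most `2 D √N G_T` (`block_regret_le`).
* Noise. The errors `signLoss - ∇f (w_t)` are martingale differences with second moment at most
  `L_i²`, so their sum over a block has expected absolute value at most `√N L_i`
  (`integral_abs_sum_range_le`), and they are uncorrelated with the directions. Together with the
  regret this gives `IsRun.block_gradient_le`.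
* Descent. Since `s_t` is uniform and independent of the past, `⟪∇f (w_t), Δ_t⟫` has expectation
  `E [f (x_t) - f (x_{t-1})]` (`IsRun.integral_inner_gradient_direction`), and the sum over all steps
  telescopes.

Hence the averaged gradient of a uniformly chosen block has expected `1`-norm at most
`Δf / (K δ) + 3 ‖L‖₁ / √N`, which is at most `ε` for the prescribed `K` and `N` (`error_bound`).

It remains to pass from the points of a block to the Goldstein measure
(`goldsteinMeasure_one_top_le`). Its definition ranges over *sets*, whereas the points of a block may
coincide with positive probability, namely where directions vanish. So every point `w_t` is replaced
by a cluster of distinct points near it with the same average and almost the same average gradient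
(`WellBehaved.exists_samples`), all clusters being of the same size. The clusters stay in the box of
radius `δ`, because the points of a block are at distance less than `δ` from their average
(`abs_queryPoint_sub_blockAverage_lt`).
-/

namespace StoSign

/-! ### Averaged gradients over sets of distinct points -/

section Goldstein

variable {d : ℕ} {f : EuclideanSpace ℝ (Fin d) → ℝ}

/-- The inner products of the sums `∇f z + ∇f (2y - z)` with `v`, for `z` near `y`, cannot all stay
below some `u < 2 ⟪∇f y, v⟫`, even if countably many `z` are left out: along the ray from `y` in
direction `v` they integrate to the central differences of `f`. -/
theorem WellBehaved.exists_inner_gradient_gt (hf : WellBehaved f) (y : EuclideanSpace ℝ (Fin d))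
    {v : EuclideanSpace ℝ (Fin d)} (hv : v ≠ 0) {ρ : ℝ} (hρ : 0 < ρ)
    {C : Set (EuclideanSpace ℝ (Fin d))} (hC : C.Countable) {u : ℝ}
    (hu : u < 2 * inner ℝ (gradient f y) v) :
    ∃ z ∈ Metric.ball y ρ, z ∉ C ∧
      u < inner ℝ (gradient f z + gradient f ((2 : ℝ) • y - z)) v := by
  by_contra! hcon
  have hv0 : 0 < ‖v‖ := norm_pos_iff.2 hv
  -- Integrating the assumed bound along the segment gives a bound on the central difference.
  have hdiff : ∀ h : ℝ, 0 < h → h < ρ / ‖v‖ → f (y + h • v) - f (y - h • v) ≤ h * u := by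
    intro h h0 hh
    have h1 := hf.ftc y (y + h • v)
    have h2 := hf.ftc y (y - h • v)
    have i1 := hf.intervalIntegrable y (y + h • v)
    have i2 := hf.intervalIntegrable y (y - h • v)
    have e : f (y + h • v) - f (y - h • v) = (f (y + h • v) - f y) - (f (y - h • v) - f y) := by
      ring
    rw [e, h1, h2, ← intervalIntegral.integral_sub i1 i2]
    have hconst : h * u = ∫ _ in (0 : ℝ)..1, h * u := by simp
    rw [hconst]
    refine intervalIntegral.integral_mono_ae_restrict zero_le_one (i1.sub i2) (by simp) ?_
    have hcount : ((fun r : ℝ => y + (r * h) • v) ⁻¹' C).Countable := by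
      refine hC.preimage_of_injOn ?_
      intro a _ b _ hab
      have h3 : (a * h) • v = (b * h) • v := add_left_cancel hab
      exact mul_right_cancel₀ h0.ne' (smul_left_injective ℝ hv h3)
    have hae : ∀ᵐ r ∂(volume.restrict (Set.Icc (0 : ℝ) 1)), y + (r * h) • v ∉ C :=
      ae_restrict_of_ae (hcount.ae_notMem volume)
    filter_upwards [hae, ae_restrict_mem measurableSet_Icc] with r hr hr01
    have hmem : y + (r * h) • v ∈ Metric.ball y ρ := by
      rw [Metric.mem_ball, dist_eq_norm, add_sub_cancel_left, norm_smul, Real.norm_eq_abs,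
        abs_of_nonneg (mul_nonneg hr01.1 h0.le)]
      calc r * h * ‖v‖ ≤ 1 * h * ‖v‖ := by gcongr; exact hr01.2
        _ < ρ := by rw [one_mul]; exact (lt_div_iff₀ hv0).1 hh
    have hle := hcon _ hmem hr
    have e1 : y + r • h • v = y + (r * h) • v := by rw [smul_smul]
    have e2 : y + r • -(h • v) = (2 : ℝ) • y - (y + (r * h) • v) := by
      rw [mul_smul]; module
    have e3 : y + h • v - y = h • v := by module
    have e4 : y - h • v - y = -(h • v) := by module
    simp only [e3, e4, e1, e2, inner_neg_right, inner_smul_right, sub_neg_eq_add]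
    rw [inner_add_left] at hle
    rw [← mul_add]
    exact mul_le_mul_of_nonneg_left hle h0.le
  -- The derivative of the central difference at `0` is `2 ⟪∇f y, v⟫`.
  have hg : HasGradientAt f (gradient f y) y := (hf.differentiable y).hasGradientAt
  have hderiv : HasDerivAt (fun h : ℝ => f (y + h • v) - f (y - h • v))
      (2 * inner ℝ (gradient f y) v) 0 := by
    have a1 : HasDerivAt (fun h : ℝ => y + h • v) v 0 := by
      simpa using ((hasDerivAt_id (0 : ℝ)).smul_const v).const_add y
    have a2 : HasDerivAt (fun h : ℝ => y - h • v) (-v) 0 := by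
      simpa using ((hasDerivAt_id (0 : ℝ)).smul_const v).const_sub y
    have hF := hg.hasFDerivAt
    have b1 := HasFDerivAt.comp_hasDerivAt_of_eq (0 : ℝ) hF a1 (by simp)
    have b2 := HasFDerivAt.comp_hasDerivAt_of_eq (0 : ℝ) hF a2 (by simp)
    have := b1.sub b2
    refine this.congr_deriv ?_
    rw [map_neg, InnerProductSpace.toDual_apply_apply]
    ring
  have hlim := hderiv.tendsto_slope_zero_right
  have : 2 * inner ℝ (gradient f y) v ≤ u := by
    refine le_of_tendsto hlim ?_
    have hpos : 0 < ρ / ‖v‖ := div_pos hρ hv0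
    filter_upwards [Ioo_mem_nhdsGT hpos] with h hh
    have := hdiff h hh.1 hh.2
    simp only [zero_add, zero_smul, add_zero, sub_zero, sub_self, smul_eq_mul]
    rw [inv_mul_le_iff₀ hh.1]
    exact this
  exact absurd hu (not_lt.2 this)

/-- `Samples f U M b c e` says that, outside every finite set, there are `M` distinct points of `U`
with sum `b` at which the gradients of `f` sum to `c`, up to an error of at most `e`. -/
def Samples (f : EuclideanSpace ℝ (Fin d) → ℝ) (U : Set (EuclideanSpace ℝ (Fin d))) (M : ℕ)
    (b c : EuclideanSpace ℝ (Fin d)) (e : ℝ) : Prop :=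
  ∀ F : Finset (EuclideanSpace ℝ (Fin d)), ∃ S : Finset (EuclideanSpace ℝ (Fin d)),
    Disjoint S F ∧ ↑S ⊆ U ∧ S.card = M ∧ ∑ z ∈ S, z = b ∧ ‖∑ z ∈ S, gradient f z - c‖ ≤ e

namespace Samples

variable {U V : Set (EuclideanSpace ℝ (Fin d))} {M M' : ℕ} {b c b' c' : EuclideanSpace ℝ (Fin d)}
  {e e' : ℝ}

theorem zero : Samples f U 0 0 0 0 := fun _ => ⟨∅, by simp, by simp, by simp, by simp, by simp⟩

theorem mono (h : Samples f U M b c e) (hUV : U ⊆ V) : Samples f V M b c e := fun F => by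
  obtain ⟨S, h1, h2, h3⟩ := h F
  exact ⟨S, h1, h2.trans hUV, h3⟩

theorem add (h : Samples f U M b c e) (h' : Samples f U M' b' c' e') :
    Samples f U (M + M') (b + b') (c + c') (e + e') := fun F => by
  classical
  obtain ⟨S, hS, hSU, hcard, hsum, hgrad⟩ := h F
  obtain ⟨S', hS', hSU', hcard', hsum', hgrad'⟩ := h' (F ∪ S)
  rw [Finset.disjoint_union_right] at hS'
  have hdisj : Disjoint S S' := hS'.2.symm
  refine ⟨S ∪ S', Finset.disjoint_union_left.2 ⟨hS, hS'.1⟩, ?_, ?_, ?_, ?_⟩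
  · rw [Finset.coe_union]; exact Set.union_subset hSU hSU'
  · rw [Finset.card_union_of_disjoint hdisj, hcard, hcard']
  · rw [Finset.sum_union hdisj, hsum, hsum']
  · rw [Finset.sum_union hdisj, add_sub_add_comm]
    exact (norm_add_le _ _).trans (add_le_add hgrad hgrad')

theorem sum {ι : Type*} (s : Finset ι) {M : ι → ℕ} {b c : ι → EuclideanSpace ℝ (Fin d)}
    {e : ι → ℝ} (h : ∀ i ∈ s, Samples f U (M i) (b i) (c i) (e i)) :
    Samples f U (∑ i ∈ s, M i) (∑ i ∈ s, b i) (∑ i ∈ s, c i) (∑ i ∈ s, e i) := by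
  classical
  induction s using Finset.induction_on with
  | empty => simpa using zero
  | insert a s ha ih =>
    simp only [Finset.sum_insert ha]
    exact (h a (Finset.mem_insert_self _ _)).add
      (ih fun i hi => h i (Finset.mem_insert_of_mem hi))

theorem nsmul (h : Samples f U M b c e) (m : ℕ) :
    Samples f U (m * M) (m • b) (m • c) (m * e) := by
  simpa using sum (Finset.range m) (fun _ _ => h)

end Samples

/-- The gradient at a point `y` can be replaced by the average gradient over arbitrarily many
disjoint clusters of distinct points near `y`, each with average `y`. Continuity of the gradient is
not available. Instead, `2 ∇f y` is in the closed convex hull of the sums `∇f z + ∇f (2y - z)`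
over those `z` near `y` whose sum is approached at infinitely many points: a separating hyperplane
would contradict the fundamental theorem of calculus in the direction of its normal, as only
countably many `z` are left out. -/
theorem WellBehaved.exists_samples [NeZero d] (hf : WellBehaved f)
    (y : EuclideanSpace ℝ (Fin d)) {ρ τ : ℝ} (hρ : 0 < ρ) (hτ : 0 < τ) :
    ∃ M > 0, Samples f (Metric.ball y ρ) M (M • y) (M • gradient f y) (M * τ) := by
  obtain ⟨σ, hστ⟩ : ∃ σ, σ = τ / 2 := ⟨_, rfl⟩
  have hσ : 0 < σ := hστ ▸ half_pos hτ
  set U := Metric.ball y ρ with hU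
  set a : EuclideanSpace ℝ (Fin d) → EuclideanSpace ℝ (Fin d) :=
    fun z => gradient f z + gradient f ((2 : ℝ) • y - z) with ha
  set Z : Set (EuclideanSpace ℝ (Fin d)) :=
    {z ∈ U | ∀ W ∈ nhds (a z), {z' ∈ U | a z' ∈ W}.Infinite} with hZ
  -- All but countably many points of the ball are in `Z`.
  have hcount : (U \ Z).Countable := by
    have hbad : ∀ p ∈ a '' (U \ Z), ∃ W ∈ nhds p, {z' ∈ U | a z' ∈ W}.Finite := by
      rintro _ ⟨z, ⟨hzU, hzZ⟩, rfl⟩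
      simp only [hZ, Set.mem_ofPred_eq, not_and, not_forall, Set.not_infinite] at hzZ
      obtain ⟨W, hW, hfin⟩ := hzZ hzU
      exact ⟨W, hW, hfin⟩
    choose! W hW hfin using hbad
    obtain ⟨t, hts, htc, hcov⟩ := TopologicalSpace.countable_cover_nhdsWithin
      (f := W) (s := a '' (U \ Z)) (fun p hp => mem_nhdsWithin_of_mem_nhds (hW p hp))
    refine (htc.biUnion fun p hp => (hfin p (hts hp)).countable).mono ?_
    intro z hz
    obtain ⟨p, hp, hzp⟩ := Set.mem_iUnion₂.1 (hcov ⟨z, hz, rfl⟩)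
    exact Set.mem_iUnion₂.2 ⟨p, hp, hz.1, hzp⟩
  have hclosure : (2 : ℝ) • gradient f y ∈ closure (convexHull ℝ (a '' Z)) := by
    by_contra hnot
    obtain ⟨l, u, hl, hlu⟩ := geometric_hahn_banach_closed_point
      (convex_convexHull ℝ (a '' Z)).closure isClosed_closure hnot
    have hl' : ∀ z ∈ Z, l (a z) < u := fun z hz =>
      hl _ (subset_closure (subset_convexHull ℝ _ ⟨z, hz, rfl⟩))
    set v := (InnerProductSpace.toDual ℝ (EuclideanSpace ℝ (Fin d))).symm l with hv
    have hlv : ∀ p, l p = inner ℝ p v := fun p => by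
      rw [real_inner_comm, hv, InnerProductSpace.toDual_symm_apply]
    rcases eq_or_ne v 0 with hv0 | hv0
    · simp only [hlv, hv0, inner_zero_right] at hl' hlu
      obtain ⟨v', hv'⟩ := exists_ne (0 : EuclideanSpace ℝ (Fin d))
      obtain ⟨z, hzU, hzC, -⟩ := hf.exists_inner_gradient_gt y hv' hρ hcount
        (sub_one_lt (2 * inner ℝ (gradient f y) v'))
      have hzZ : z ∈ Z := by by_contra h; exact hzC ⟨hzU, h⟩
      exact absurd (hl' z hzZ) (not_lt.2 hlu.le)
    · simp only [hlv] at hl' hlu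
      rw [inner_smul_left] at hlu
      obtain ⟨z, hzU, hzC, hz⟩ := hf.exists_inner_gradient_gt y hv0 hρ hcount hlu
      have hzZ : z ∈ Z := by by_contra h; exact hzC ⟨hzU, h⟩
      exact absurd (hl' z hzZ) (not_lt.2 hz.le)
  -- Near every value on `Z` there are clusters of two points.
  have hpair : ∀ z ∈ Z, Samples f U 2 ((2 : ℕ) • y) (a z) σ := by
    classical
    intro z hz F
    have hinf := hz.2 (Metric.closedBall (a z) σ) (Metric.closedBall_mem_nhds _ hσ)
    obtain ⟨z', hz', hz'F⟩ := hinf.exists_notMem_finset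
      (insert y F ∪ F.image fun x => (2 : ℝ) • y - x)
    simp only [Finset.mem_union, Finset.mem_insert, Finset.mem_image, not_or, not_exists,
      not_and] at hz'F
    obtain ⟨⟨hne, hF⟩, hF'⟩ := hz'F
    have hne' : z' ≠ (2 : ℝ) • y - z' := by
      intro h
      apply hne
      have h2 : (2 : ℝ) • z' = (2 : ℝ) • y := by
        rw [two_smul]; nth_rewrite 2 [h]; abel
      exact smul_right_injective _ (two_ne_zero) h2
    refine ⟨{z', (2 : ℝ) • y - z'}, ?_, ?_, Finset.card_pair hne', ?_, ?_⟩
    · rw [Finset.disjoint_left]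
      intro x hx hxF
      rcases Finset.mem_insert.1 hx with rfl | hx
      · exact hF hxF
      · rw [Finset.mem_singleton] at hx
        subst hx
        exact hF' _ hxF (by abel)
    · intro x hx
      rcases Finset.mem_insert.1 (Finset.mem_coe.1 hx) with rfl | hx
      · exact hz'.1
      · rw [Finset.mem_singleton] at hx
        have h1 := hz'.1
        rw [hU, Metric.mem_ball, dist_eq_norm] at h1 ⊢
        rw [hx, show (2 : ℝ) • y - z' - y = -(z' - y) by module, norm_neg]
        exact h1
    · rw [Finset.sum_pair hne', two_smul, two_smul]; abel
    · rw [Finset.sum_pair hne', ← dist_eq_norm]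
      exact hz'.2
  obtain ⟨q, hq, hqσ⟩ := Metric.mem_closure_iff.1 hclosure σ hσ
  obtain ⟨ι, _, lam, p, hlam0, hlam1, hpZ, hpq⟩ := mem_convexHull_iff_exists_fintype.1 hq
  choose z hzZ hza using hpZ
  -- Round the weights up to multiples of `1 / n`, for `n` large.
  set Cq : ℝ := ∑ i, ‖p i - q‖ with hCq
  obtain ⟨n, hn⟩ := exists_nat_gt (max (Cq / σ) 0)
  have hn0 : (0 : ℝ) < n := lt_of_le_of_lt (le_max_right _ _) hn
  have hnC : Cq ≤ n * σ := ((div_lt_iff₀ hσ).1 (lt_of_le_of_lt (le_max_left _ _) hn)).le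
  set m : ι → ℕ := fun i => ⌈n * lam i⌉₊ with hm
  set M := ∑ i, m i with hM
  have hMn : (n : ℝ) ≤ M := by
    rw [hM]; push_cast
    calc (n : ℝ) = ∑ i, n * lam i := by rw [← Finset.mul_sum, hlam1, mul_one]
      _ ≤ ∑ i, (m i : ℝ) := Finset.sum_le_sum fun i _ => Nat.le_ceil _
  have hM0 : (0 : ℝ) < M := hn0.trans_le hMn
  have herr : ‖∑ i, m i • p i - M • q‖ ≤ M * σ := by
    have e1 : ∑ i, m i • p i - M • q = ∑ i, ((m i : ℝ) - n * lam i) • (p i - q) := by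
      have e2 : ∑ i, (n * lam i) • (p i - q) = 0 := by
        simp only [mul_smul, smul_sub, Finset.sum_sub_distrib, ← Finset.smul_sum, hpq]
        rw [← Finset.sum_smul, hlam1, one_smul, sub_self]
      simp only [sub_smul, Finset.sum_sub_distrib] at e2 ⊢
      rw [e2, sub_zero]
      simp only [smul_sub, Finset.sum_sub_distrib, hM, Nat.cast_smul_eq_nsmul, Finset.sum_smul]
    rw [e1]
    calc _ ≤ ∑ i, ‖((m i : ℝ) - n * lam i) • (p i - q)‖ := norm_sum_le _ _
      _ ≤ ∑ i, ‖p i - q‖ := by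
        refine Finset.sum_le_sum fun i _ => ?_
        rw [norm_smul]
        refine mul_le_of_le_one_left (norm_nonneg _) ?_
        rw [Real.norm_eq_abs, abs_le]
        have h1 := Nat.le_ceil ((n : ℝ) * lam i)
        have h2 := Nat.ceil_lt_add_one (mul_nonneg hn0.le (hlam0 i))
        constructor <;> simp only [hm] <;> linarith
      _ ≤ n * σ := hnC
      _ ≤ M * σ := by gcongr
  have hsamp := Samples.sum Finset.univ (fun i _ => (hpair (z i) (hzZ i)).nsmul (m i))
  refine ⟨M * 2, by
    have : 0 < M := by exact_mod_cast hM0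
    omega, fun F => ?_⟩
  obtain ⟨S, h1, h2, h3, h4, h5⟩ := hsamp F
  refine ⟨S, h1, h2, ?_, ?_, ?_⟩
  · rw [h3, ← Finset.sum_mul]
  · rw [h4, ← Finset.sum_smul, mul_smul]
  · simp only [hza] at h5
    have e : ∑ z ∈ S, gradient f z - (M * 2) • gradient f y
        = (∑ z ∈ S, gradient f z - ∑ i, m i • p i) + (∑ i, m i • p i - M • q)
          - M • ((2 : ℝ) • gradient f y - q) := by
      rw [mul_smul, two_smul, two_smul, smul_sub]; abel
    rw [e]
    have h6 : ‖M • ((2 : ℝ) • gradient f y - q)‖ ≤ M * σ := by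
      rw [← Nat.cast_smul_eq_nsmul ℝ, norm_smul, Real.norm_natCast, ← dist_eq_norm]
      gcongr
    calc _ ≤ ‖∑ z ∈ S, gradient f z - ∑ i, m i • p i‖ + ‖∑ i, m i • p i - M • q‖
          + ‖M • ((2 : ℝ) • gradient f y - q)‖ :=
        (norm_sub_le _ _).trans (add_le_add_left (norm_add_le _ _) _)
      _ ≤ M * σ + M * σ + M * σ := by
        refine add_le_add (add_le_add (h5.trans_eq ?_) herr) h6
        rw [← Finset.sum_mul, hM]; push_cast; rfl
      _ ≤ ((M * 2 : ℕ) : ℝ) * τ := by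
        have h7 : 0 ≤ (M : ℝ) * τ := (mul_pos hM0 hτ).le
        push_cast
        rw [hστ]
        linarith

/-- The average gradient over a finite family of points, which need not be distinct, bounds the
Goldstein measure at the average of the points, if these are in the interior of the box. -/
theorem goldsteinMeasure_one_top_le [NeZero d] (hf : WellBehaved f) {N : ℕ} (hN : 0 < N)
    {δ : ℝ} (w : ℕ → EuclideanSpace ℝ (Fin d)) (J : Finset ℕ) (hJ : J.card = N)
    (x : EuclideanSpace ℝ (Fin d)) (hx : (N : ℝ)⁻¹ • ∑ j ∈ J, w j = x)
    (hw : ∀ j ∈ J, ∀ i, |w j i - x i| < δ) :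
    goldsteinMeasure 1 ⊤ f δ x ≤ ∑ i, |(N : ℝ)⁻¹ * ∑ j ∈ J, gradient f (w j) i| := by
  have hJne : J.Nonempty := Finset.card_pos.1 (hJ ▸ hN)
  have hN0 : (0 : ℝ) < N := by exact_mod_cast hN
  have hδ : 0 < δ := by
    obtain ⟨j, hj⟩ := hJne
    exact (abs_nonneg _).trans_lt (hw j hj 0)
  -- The box is a neighbourhood of each of the averaged points.
  have hball : ∀ j ∈ J, ∃ ρ > 0, Metric.ball (w j) ρ ⊆ lpBall ⊤ x δ := by
    intro j hj
    have hev : ∀ i, ∀ᶠ z : EuclideanSpace ℝ (Fin d) in nhds (w j), |z i - x i| < δ := fun i =>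
      (show Continuous fun z : EuclideanSpace ℝ (Fin d) => |z i - x i| by fun_prop).continuousAt
        (Iio_mem_nhds (hw j hj i))
    refine Metric.mem_nhds_iff.1 ((Filter.eventually_all.2 hev).mono fun z hz => ?_)
    exact (lpNorm_top_le_iff _ hδ.le).2 fun i => (hz i).le
  refine le_of_forall_pos_le_add fun τ hτ => ?_
  have hd : (0 : ℝ) < d := by exact_mod_cast Nat.pos_of_ne_zero (NeZero.ne d)
  have hτd : 0 < τ / d := div_pos hτ hd
  choose! ρ hρ hρsub using hball
  have hex := fun j => fun hj : j ∈ J => hf.exists_samples (w j) (hρ j hj) hτd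
  choose! M hM hS using hex
  -- A common multiple makes all clusters equally large.
  set P := ∏ j ∈ J, M j with hP
  have hP0 : 0 < P := Finset.prod_pos hM
  have hPr : (0 : ℝ) < P := by exact_mod_cast hP0
  have hS' : ∀ j ∈ J, Samples f (lpBall ⊤ x δ) P (P • w j) (P • gradient f (w j)) (P * (τ / d)) := by
    intro j hj
    obtain ⟨m, hm⟩ := Finset.dvd_prod_of_mem M hj
    have h := ((hS j hj).mono (hρsub j hj)).nsmul m
    rw [smul_smul, smul_smul, ← mul_assoc, ← Nat.cast_mul, mul_comm m, ← hm] at h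
    exact h
  obtain ⟨S, -, hSU, hcard, hsum, hgrad⟩ := Samples.sum J hS' ∅
  have hcard' : S.card = N * P := by rw [hcard, Finset.sum_const, hJ, smul_eq_mul]
  have hcard0 : 0 < S.card := hcard' ▸ Nat.mul_pos hN hP0
  have hbdd : BddBelow {v : ℝ | ∃ S : Finset (EuclideanSpace ℝ (Fin d)), S.Nonempty ∧
      (∀ y ∈ S, y ∈ lpBall ⊤ x δ) ∧ (S.card : ℝ)⁻¹ • ∑ y ∈ S, y = x ∧
      v = lpNorm 1 (fun i => ((S.card : ℝ)⁻¹ • ∑ y ∈ S, gradient f y) i)} := by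
    refine ⟨0, ?_⟩
    rintro _ ⟨S, -, -, -, rfl⟩
    rw [lpNorm_one]
    positivity
  refine (csInf_le hbdd ⟨S, Finset.card_pos.1 hcard0, fun y hy => hSU hy, ?_, rfl⟩).trans ?_
  · rw [hsum, ← Finset.smul_sum, hcard', ← hx, ← Nat.cast_smul_eq_nsmul ℝ, smul_smul]
    congr 1
    push_cast
    field_simp
  · rw [lpNorm_one]
    have hi : ∀ i, |((S.card : ℝ)⁻¹ • ∑ y ∈ S, gradient f y) i|
        ≤ |(N : ℝ)⁻¹ * ∑ j ∈ J, gradient f (w j) i| + τ / d := by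
      intro i
      have h1 := (PiLp.norm_apply_le (∑ z ∈ S, gradient f z - ∑ j ∈ J, P • gradient f (w j)) i).trans
        hgrad
      rw [← Finset.smul_sum, ← Nat.cast_smul_eq_nsmul ℝ, Finset.sum_const, hJ, nsmul_eq_mul,
        PiLp.sub_apply, PiLp.smul_apply, smul_eq_mul, Real.norm_eq_abs] at h1
      rw [PiLp.smul_apply, smul_eq_mul, hcard']
      have hNP : (0 : ℝ) < (N : ℝ) * P := mul_pos hN0 hPr
      have e : ((N * P : ℕ) : ℝ)⁻¹ * (∑ y ∈ S, gradient f y) i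
          = (N : ℝ)⁻¹ * ∑ j ∈ J, gradient f (w j) i + ((N : ℝ) * P)⁻¹ *
            ((∑ y ∈ S, gradient f y) i - P * (∑ j ∈ J, gradient f (w j)) i) := by
        rw [WithLp.ofLp_sum, Finset.sum_apply, WithLp.ofLp_sum, Finset.sum_apply]
        push_cast
        field_simp
        ring
      rw [e]
      refine (abs_add_le _ _).trans (add_le_add_right ?_ _)
      rw [abs_mul, abs_of_pos (inv_pos.2 hNP), inv_mul_le_iff₀ hNP]
      linarith
    calc _ ≤ ∑ i, (|(N : ℝ)⁻¹ * ∑ j ∈ J, gradient f (w j) i| + τ / d) :=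
          Finset.sum_le_sum fun i _ => hi i
      _ = _ := by
        rw [Finset.sum_add_distrib, Finset.sum_const, Finset.card_univ, Fintype.card_fin,
          nsmul_eq_mul, mul_div_cancel₀ _ hd.ne']

end Goldstein

/-! ### Regret of clipped sign descent in one coordinate -/

/-- One step of clipped descent along `σ`: the loss `G σ (z - u)` against a comparator `u` of the
interval is paid for by the decrease of the squared distance to `u`. -/
theorem sign_step_le {D η G σ z u : ℝ} (hη : 0 < η) (hG : 0 ≤ G) (hσ : |σ| ≤ 1) (hD : 0 ≤ D)
    (hu : |u| ≤ D) :
    G * σ * (z - u) ≤ G * (z - u) ^ 2 / (2 * η)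
      - G * (max (-D) (min D (z - η * σ)) - u) ^ 2 / (2 * η) + G * η / 2 := by
  have h1 := clip_key (y := z - η * σ) hD hu
  set c := max (-D) (min D (z - η * σ))
  have h2 : σ ^ 2 ≤ 1 := (sq_le_one_iff_abs_le_one σ).2 hσ
  have h3 : (c - u) ^ 2 ≤ (u - (z - η * σ)) ^ 2 := by nlinarith [sq_nonneg (c - (z - η * σ))]
  have h4 : η * σ * (z - u) * 2 ≤ (z - u) ^ 2 - (c - u) ^ 2 + η ^ 2 := by
    nlinarith [mul_le_mul_of_nonneg_left h2 (sq_nonneg η)]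
  have h5 := mul_le_mul_of_nonneg_left h4 (div_nonneg hG (by positivity : 0 ≤ 2 * η))
  have e1 : G / (2 * η) * (η * σ * (z - u) * 2) = G * σ * (z - u) := by field_simp
  have e2 : G / (2 * η) * ((z - u) ^ 2 - (c - u) ^ 2 + η ^ 2) = G * (z - u) ^ 2 / (2 * η)
      - G * (c - u) ^ 2 / (2 * η) + G * η / 2 := by field_simp
  rwa [e1, e2] at h5

/-- The regret of clipped sign descent with losses `h j`, weights `G j` and positions `z j`. The
last loss need not be of the form `G j * σ`, as no step is made after it. -/
theorem sign_regret_le {D η u : ℝ} (hη : 0 < η) (hD : 0 ≤ D) (hu : |u| ≤ D) {m : ℕ}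
    {G h z : ℕ → ℝ} (hG0 : ∀ j, 0 ≤ G j) (hG : Monotone G) (hz : ∀ j, |z j| ≤ D)
    (hh : |h m| ≤ G m)
    (hstep : ∀ j < m, ∃ σ : ℝ, |σ| ≤ 1 ∧ h j = G j * σ ∧
      z (j + 1) = max (-D) (min D (z j - η * σ))) :
    ∑ j ∈ Finset.range (m + 1), h j * (z j - u) ≤
      G m * (2 * D ^ 2 / η + η * (m + 1) / 2) := by
  have hdist : ∀ j, (z j - u) ^ 2 ≤ 4 * D ^ 2 := fun j => by
    have h1 := abs_le.1 (hz j)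
    have h2 := abs_le.1 hu
    nlinarith [h1.1, h1.2, h2.1, h2.2]
  have hind : ∀ k ≤ m, ∑ j ∈ Finset.range k, h j * (z j - u) ≤
      G k * (2 * D ^ 2 / η + η * k / 2) - G k * (z k - u) ^ 2 / (2 * η) := by
    intro k
    induction k with
    | zero =>
      intro _
      have h1 := mul_le_mul_of_nonneg_left (hdist 0) (div_nonneg (hG0 0) (by positivity :
        0 ≤ 2 * η))
      have e : G 0 / (2 * η) * (4 * D ^ 2) = G 0 * (2 * D ^ 2 / η) := by field_simp; ring
      have e' : G 0 / (2 * η) * (z 0 - u) ^ 2 = G 0 * (z 0 - u) ^ 2 / (2 * η) := by ring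
      rw [e, e'] at h1
      simp only [Finset.range_zero, Finset.sum_empty, Nat.cast_zero, mul_zero, zero_div, add_zero]
      linarith
    | succ k ih =>
      intro hk
      obtain ⟨σ, hσ, hhσ, hzσ⟩ := hstep k hk
      rw [Finset.sum_range_succ]
      have h1 := ih (by omega)
      have h2 := sign_step_le (z := z k) hη (hG0 k) hσ hD hu
      rw [← hhσ, ← hzσ] at h2
      have h3 : 0 ≤ (G (k + 1) - G k) * ((2 * D ^ 2 / η - (z (k + 1) - u) ^ 2 / (2 * η))
          + η * (k + 1) / 2) := by
        refine mul_nonneg (sub_nonneg.2 (hG (Nat.le_succ k))) (add_nonneg ?_ (by positivity))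
        rw [sub_nonneg, div_le_div_iff₀ (by positivity) hη]
        nlinarith [hdist (k + 1)]
      push_cast
      have e : G (k + 1) * (2 * D ^ 2 / η + η * (k + 1) / 2)
          - G (k + 1) * (z (k + 1) - u) ^ 2 / (2 * η)
          = (G k * (2 * D ^ 2 / η + η * k / 2) + G k * η / 2 - G k * (z (k + 1) - u) ^ 2 / (2 * η))
          + (G (k + 1) - G k) * ((2 * D ^ 2 / η - (z (k + 1) - u) ^ 2 / (2 * η))
          + η * (k + 1) / 2) := by ring
      linarith
  rw [Finset.sum_range_succ]
  have h1 := hind m le_rfl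
  have h2 : h m * (z m - u) ≤ G m * ((z m - u) ^ 2 / (2 * η) + η / 2) := by
    have h3 : |z m - u| ≤ (z m - u) ^ 2 / (2 * η) + η / 2 := by
      rw [← sub_nonneg]
      have : (z m - u) ^ 2 / (2 * η) + η / 2 - |z m - u| = (|z m - u| - η) ^ 2 / (2 * η) := by
        rw [← sq_abs (z m - u)]; field_simp; ring
      rw [this]; positivity
    calc h m * (z m - u) ≤ |h m| * |z m - u| := by rw [← abs_mul]; exact le_abs_self _
      _ ≤ _ := mul_le_mul hh h3 (abs_nonneg _) (hG0 m)
  have e : G m * (2 * D ^ 2 / η + η * (m + 1) / 2) =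
      (G m * (2 * D ^ 2 / η + η * m / 2) - G m * (z m - u) ^ 2 / (2 * η))
      + G m * ((z m - u) ^ 2 / (2 * η) + η / 2) := by ring
  linarith

/-! ### Integration over fresh randomness -/

section Probability

/-- Fresh randomness `Y` can be integrated out. -/
theorem integral_comp_indep {Ω α β : Type*} [MeasurableSpace α] [MeasurableSpace β]
    {m mΩ : MeasurableSpace Ω} {μ : Measure Ω} [IsProbabilityMeasure μ] (hm : m ≤ mΩ)
    {X : Ω → α} (hX : Measurable[m] X) {Y : Ω → β}
    (hY : Measurable Y) (hindep : Indep (MeasurableSpace.comap Y inferInstance) m μ)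
    {φ : α × β → ℝ} (hφ : Measurable φ) (hint : Integrable (fun ω => φ (X ω, Y ω)) μ) :
    Integrable (fun ω => ∫ y, φ (X ω, y) ∂(μ.map Y)) μ ∧
      ∫ ω, φ (X ω, Y ω) ∂μ = ∫ ω, ∫ y, φ (X ω, y) ∂(μ.map Y) ∂μ := by
  have hX' : Measurable X := hX.mono hm le_rfl
  have hI : IndepFun X Y μ := by
    refine (IndepFun_iff_Indep X Y μ).2 (indep_of_indep_of_le_left hindep.symm ?_)
    exact measurable_iff_comap_le.1 hX
  have := Measure.isProbabilityMeasure_map (μ := μ) hX'.aemeasurable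
  have := Measure.isProbabilityMeasure_map (μ := μ) hY.aemeasurable
  have hmap := (indepFun_iff_map_prod_eq_prod_map_map hX'.aemeasurable hY.aemeasurable).1 hI
  have hXY : Measurable fun ω => (X ω, Y ω) := hX'.prodMk hY
  have hint' : Integrable φ ((μ.map X).prod (μ.map Y)) := by
    rw [← hmap]
    exact (integrable_map_measure hφ.aestronglyMeasurable hXY.aemeasurable).2 hint
  refine ⟨hint'.integral_prod_left.comp_measurable hX', ?_⟩
  rw [← integral_map hXY.aemeasurable hφ.aestronglyMeasurable, hmap, integral_prod _ hint',
    integral_map hX'.aemeasurable]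
  exact hint'.integral_prod_left.aestronglyMeasurable

variable {Ω : Type*} {mΩ : MeasurableSpace Ω} {μ : Measure Ω}

theorem integral_comp_of_isUniform_Icc {s : Ω → ℝ} {a b : ℝ} (hab : a < b)
    (hs : pdf.IsUniform s (Set.Icc a b) μ volume) (φ : ℝ → ℝ) :
    ∫ r, φ r ∂(μ.map s) = (b - a)⁻¹ * ∫ r in a..b, φ r := by
  rw [show μ.map s = _ from hs, ProbabilityTheory.cond, integral_smul_measure, Real.volume_Icc,
    intervalIntegral.integral_of_le hab.le, integral_Icc_eq_integral_Ioc, ENNReal.toReal_inv,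
    ENNReal.toReal_ofReal (sub_nonneg.2 hab.le), smul_eq_mul]

/-- The coordinates of a uniform point of the cube `[-1, 1]^d` are uniform on `[-1, 1]`. -/
theorem isUniform_apply_of_isUniform_Icc {d : ℕ} {n : Ω → Fin d → ℝ} (hn : Measurable n)
    (h : pdf.IsUniform n (Set.Icc (fun _ => (-1 : ℝ)) (fun _ => (1 : ℝ))) μ volume) (i : Fin d) :
    pdf.IsUniform (fun ω => n ω i) (Set.Icc (-1 : ℝ) 1) μ volume := by
  have h0 : (volume (Set.Icc (-1 : ℝ) 1)) ≠ 0 := by simp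
  have hcond : ProbabilityTheory.cond (volume : Measure (Fin d → ℝ))
      (Set.Icc (fun _ => (-1 : ℝ)) (fun _ => (1 : ℝ)))
      = Measure.pi fun _ => ProbabilityTheory.cond (volume : Measure ℝ) (Set.Icc (-1) 1) := by
    have := cond_isProbabilityMeasure_of_finite h0 (by simp)
    refine (Measure.pi_eq fun s hs => ?_).symm
    have hIcc : Set.Icc (fun _ : Fin d => (-1 : ℝ)) (fun _ => (1 : ℝ))
        = Set.univ.pi fun _ => Set.Icc (-1 : ℝ) 1 := by
      rw [Set.pi_univ_Icc]
    rw [hIcc, cond_apply (MeasurableSet.univ_pi fun _ => measurableSet_Icc), ← Set.pi_inter_distrib,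
      volume_pi_pi, volume_pi_pi]
    simp only [cond_apply measurableSet_Icc]
    rw [Finset.prod_mul_distrib, ENNReal.prod_inv_distrib]
    intro _ _ _ _ _
    simp
  have := cond_isProbabilityMeasure_of_finite h0 (by simp)
  have := (measurePreserving_eval (fun _ : Fin d =>
    ProbabilityTheory.cond (volume : Measure ℝ) (Set.Icc (-1) 1)) i).map_eq
  rw [← hcond, ← (show μ.map n = _ from h), Measure.map_map (measurable_pi_apply i) hn] at this
  exact this

/-- The sign of `g + G r` for uniform `r`, scaled by `G`, is unbiased for `g`; the
factor `2` is the length of the interval. -/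
theorem integral_sign_add_mul {g G : ℝ} (hgG : |g| ≤ G) :
    ∫ r in (-1 : ℝ)..1, G * Real.sign (g + G * r) = 2 * g := by
  rcases (abs_nonneg g).trans hgG |>.eq_or_lt with hG | hG
  · subst hG
    simp [abs_nonpos_iff.1 hgG]
  · have hgG' := abs_le.1 hgG
    have h1 : -1 ≤ -(g / G) := by
      rw [neg_le_neg_iff, div_le_one hG]; exact hgG'.2
    have h2 : -(g / G) ≤ 1 := by
      rw [neg_le, le_div_iff₀ hG]; linarith
    have e1 : ∀ r ∈ Set.Ioo (-1 : ℝ) (-(g / G)), G * Real.sign (g + G * r) = -G := by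
      intro r hr
      have : r * G < -g := by
        have := hr.2; rw [← neg_div, lt_div_iff₀ hG] at this; exact this
      rw [Real.sign_of_neg (by linarith)]; ring
    have e2 : ∀ r ∈ Set.Ioo (-(g / G)) (1 : ℝ), G * Real.sign (g + G * r) = G := by
      intro r hr
      have : -g < r * G := by
        have := hr.1; rw [← neg_div, div_lt_iff₀ hG] at this; exact this
      rw [Real.sign_of_pos (by linarith)]; ring
    have i1 : IntervalIntegrable (fun r => G * Real.sign (g + G * r)) volume (-1) (-(g / G)) :=
      (intervalIntegrable_const (c := -G)).congr_uIoo (by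
        rw [Set.uIoo_of_le h1]; exact fun r hr => (e1 r hr).symm)
    have i2 : IntervalIntegrable (fun r => G * Real.sign (g + G * r)) volume (-(g / G)) 1 :=
      (intervalIntegrable_const (c := G)).congr_uIoo (by
        rw [Set.uIoo_of_le h2]; exact fun r hr => (e2 r hr).symm)
    rw [← intervalIntegral.integral_add_adjacent_intervals i1 i2,
      intervalIntegral.integral_congr_uIoo (a := -1) (g := fun _ => -G) (by rwa [Set.uIoo_of_le h1]),
      intervalIntegral.integral_congr_uIoo (b := 1) (g := fun _ => G) (by rwa [Set.uIoo_of_le h2])]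
    simp only [intervalIntegral.integral_const, smul_eq_mul]
    field_simp
    ring

/-- Sums of pairwise uncorrelated variables: the second moment grows linearly. -/
theorem integral_abs_sum_range_le [IsProbabilityMeasure μ] {ξ : ℕ → Ω → ℝ} {N : ℕ} {L : ℝ}
    (hL : 0 ≤ L)
    (hξ : ∀ j < N, MemLp (ξ j) 2 μ)
    (horth : ∀ j < N, ∫ ω, (∑ l ∈ Finset.range j, ξ l ω) * ξ j ω ∂μ = 0)
    (hbound : ∀ j < N, ∫ ω, ξ j ω ^ 2 ∂μ ≤ L ^ 2) :
    ∫ ω, |∑ j ∈ Finset.range N, ξ j ω| ∂μ ≤ Real.sqrt N * L := by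
  have hmem : ∀ k ≤ N, MemLp (fun ω => ∑ j ∈ Finset.range k, ξ j ω) 2 μ := fun k hk =>
    memLp_finsetSum _ fun j hj => hξ j ((Finset.mem_range.1 hj).trans_le hk)
  have hsq : ∀ k ≤ N, ∫ ω, (∑ j ∈ Finset.range k, ξ j ω) ^ 2 ∂μ ≤ k * L ^ 2 := by
    intro k
    induction k with
    | zero => simp
    | succ k ih =>
      intro hk
      have hk' : k < N := hk
      have e : ∀ ω, (∑ j ∈ Finset.range (k + 1), ξ j ω) ^ 2 = (∑ j ∈ Finset.range k, ξ j ω) ^ 2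
          + (2 * ((∑ j ∈ Finset.range k, ξ j ω) * ξ k ω) + ξ k ω ^ 2) := fun ω => by
        rw [Finset.sum_range_succ]; ring
      have i1 := (hmem k hk'.le).integrable_sq
      have i2 : Integrable (fun ω => (∑ j ∈ Finset.range k, ξ j ω) * ξ k ω) μ :=
        (hmem k hk'.le).integrable_mul (hξ k hk')
      have i3 := (hξ k hk').integrable_sq
      have i4 : Integrable (fun ω => 2 * ((∑ j ∈ Finset.range k, ξ j ω) * ξ k ω) + ξ k ω ^ 2) μ :=
        (i2.const_mul 2).add i3
      simp only [e]
      rw [integral_add i1 i4,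
        integral_add (i2.const_mul 2) i3, integral_const_mul, horth k hk']
      have := ih hk'.le
      have := hbound k hk'
      push_cast
      linarith
  have habs : MemLp (fun ω => |∑ j ∈ Finset.range N, ξ j ω|) 2 μ := (hmem N le_rfl).norm
  have hvar := variance_nonneg (fun ω => |∑ j ∈ Finset.range N, ξ j ω|) μ
  rw [variance_eq_sub habs] at hvar
  have h1 : (∫ ω, |∑ j ∈ Finset.range N, ξ j ω| ∂μ) ^ 2 ≤ N * L ^ 2 := by
    refine le_trans ?_ (hsq N le_rfl)
    simpa only [Pi.pow_apply, sq_abs, sub_nonneg] using hvar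
  rw [← abs_of_nonneg (integral_nonneg fun ω => abs_nonneg (∑ j ∈ Finset.range N, ξ j ω))]
  refine abs_le_of_sq_le_sq ?_ (by positivity)
  rwa [mul_pow, Real.sq_sqrt (Nat.cast_nonneg N)]

end Probability

/-! ### Measurability of the iterates -/

section Measurability

variable {Ω : Type*} {d : ℕ} {g : ℕ → Ω → EuclideanSpace ℝ (Fin d)} {s : ℕ → Ω → ℝ}
  {n : ℕ → Ω → Fin d → ℝ}

theorem measurable_real_sign : Measurable Real.sign :=
  Measurable.ite measurableSet_Iio measurable_const
    (Measurable.ite measurableSet_Ioi measurable_const measurable_const)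

theorem measurable_gradient (f : EuclideanSpace ℝ (Fin d) → ℝ) : Measurable (gradient f) :=
  (InnerProductSpace.toDual ℝ (EuclideanSpace ℝ (Fin d))).symm.continuous.measurable.comp
    (measurable_fderiv ℝ f)

theorem measurable_euclideanSpace_iff {m : MeasurableSpace Ω} {F : Ω → EuclideanSpace ℝ (Fin d)} :
    Measurable F ↔ ∀ i, Measurable fun ω => F ω i :=
  ⟨fun h i => (EuclideanSpace.proj i : EuclideanSpace ℝ (Fin d) →L[ℝ] ℝ).continuous.measurable.comp h,
    fun h => (PiLp.continuous_toLp 2 (fun _ : Fin d => ℝ)).measurable.comp (measurable_pi_iff.2 h)⟩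

/-- The measurability lemmas are stated for an arbitrary `σ`-algebra, so that they apply to the
histories. The values at the index `0` of `g` and `s` are not used by the algorithm and need not be
measurable. -/
theorem measurable_gradMax {m : MeasurableSpace Ω} {a : ℕ}
    (hg : ∀ j, 1 ≤ j → j ≤ a → Measurable (g j)) {t : ℕ} (ht : t ≤ a) (i : Fin d) :
    Measurable fun ω => gradMax (fun j => g j ω) t i := by
  induction t with
  | zero => exact measurable_const
  | succ t ih =>
    exact (ih (by omega)).max
      (measurable_euclideanSpace_iff.1 (hg (t + 1) (by omega) ht) i).abs

theorem measurable_direction {m : MeasurableSpace Ω} {a c : ℕ}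
    (hg : ∀ j, 1 ≤ j → j ≤ a → Measurable (g j)) (hn : ∀ j < c, Measurable (n j))
    {D : ℝ} {η : ℕ → ℝ} (hη : η 0 = 0) {Δ₀ : EuclideanSpace ℝ (Fin d)} {t : ℕ} (hta : t ≤ a + 1)
    (htc : t ≤ c) :
    Measurable fun ω => direction D η Δ₀ (fun j => g j ω) (fun j => n j ω) t := by
  induction t with
  | zero => exact measurable_const
  | succ t ih =>
    refine measurable_euclideanSpace_iff.2 fun i => measurable_const.max (measurable_const.min ?_)
    simp only [PiLp.sub_apply, PiLp.smul_apply, smul_eq_mul]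
    refine (measurable_euclideanSpace_iff.1 (ih (by omega) (by omega)) i).sub ?_
    -- `g 0` need not be measurable, but its coefficient `η 0` vanishes.
    rcases Nat.eq_zero_or_pos t with rfl | ht
    · simp [hη]
    · refine (measurable_real_sign.comp ?_).const_mul _
      exact (measurable_euclideanSpace_iff.1 (hg t ht (by omega)) i).add
        ((measurable_gradMax hg (by omega) i).mul (measurable_pi_iff.1 (hn t htc) i))

theorem measurable_iterate {m : MeasurableSpace Ω} {a c : ℕ}
    (hg : ∀ j, 1 ≤ j → j ≤ a → Measurable (g j)) (hn : ∀ j < c, Measurable (n j))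
    {D : ℝ} {η : ℕ → ℝ} (hη : η 0 = 0) {x₀ Δ₀ : EuclideanSpace ℝ (Fin d)} {t : ℕ}
    (hta : t ≤ a + 1) (htc : t ≤ c) :
    Measurable fun ω => iterate D η x₀ Δ₀ (fun j => g j ω) (fun j => n j ω) t := by
  induction t with
  | zero => exact measurable_const
  | succ t ih =>
    exact (ih (by omega) (by omega)).add (measurable_direction hg hn hη hta htc)

theorem measurable_queryPoint {m : MeasurableSpace Ω} {a b c : ℕ}
    (hg : ∀ j, 1 ≤ j → j ≤ a → Measurable (g j)) (hs : ∀ j, 1 ≤ j → j ≤ b → Measurable (s j))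
    (hn : ∀ j < c, Measurable (n j))
    {D : ℝ} {η : ℕ → ℝ} (hη : η 0 = 0) {x₀ Δ₀ : EuclideanSpace ℝ (Fin d)} {t : ℕ}
    (hta : t ≤ a) (htb : t + 1 ≤ b) (htc : t + 1 ≤ c) :
    Measurable fun ω => queryPoint D η x₀ Δ₀ (fun j => g j ω) (fun j => n j ω)
      (fun j => s j ω) (t + 1) :=
  (measurable_iterate hg hn hη (by omega) (by omega)).add
    ((hs (t + 1) (by omega) htb).smul (measurable_direction hg hn hη (by omega) htc))

theorem measurable_history_gradient {a b c j : ℕ} (h1 : 1 ≤ j) (hj : j ≤ a) :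
    Measurable[history g s n a b c] (g j) := by
  refine measurable_iff_comap_le.2 (le_trans ?_ (le_sup_left.trans le_sup_left))
  exact le_iSup₂_of_le (f := fun j _ => MeasurableSpace.comap (g j) inferInstance) j
    (Finset.mem_Icc.2 ⟨h1, hj⟩) le_rfl

theorem measurable_history_scaling {a b c j : ℕ} (h1 : 1 ≤ j) (hj : j ≤ b) :
    Measurable[history g s n a b c] (s j) := by
  refine measurable_iff_comap_le.2 (le_trans ?_ (le_sup_right.trans le_sup_left))
  exact le_iSup₂_of_le (f := fun j _ => MeasurableSpace.comap (s j) inferInstance) j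
    (Finset.mem_Icc.2 ⟨h1, hj⟩) le_rfl

theorem measurable_history_noise {a b c j : ℕ} (hj : j < c) :
    Measurable[history g s n a b c] (n j) := by
  refine measurable_iff_comap_le.2 (le_trans ?_ (le_sup_right))
  exact le_iSup₂_of_le (f := fun j _ => MeasurableSpace.comap (n j) inferInstance) j
    (Finset.mem_range.2 hj) le_rfl

theorem history_mono {a b c a' b' c' : ℕ} (ha : a ≤ a') (hb : b ≤ b') (hc : c ≤ c') :
    history g s n a b c ≤ history g s n a' b' c' := by
  refine sup_le (sup_le (iSup₂_le fun j hj => ?_) (iSup₂_le fun j hj => ?_))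
    (iSup₂_le fun j hj => ?_)
  · rw [Finset.mem_Icc] at hj
    exact measurable_iff_comap_le.1 (measurable_history_gradient hj.1 (hj.2.trans ha))
  · rw [Finset.mem_Icc] at hj
    exact measurable_iff_comap_le.1 (measurable_history_scaling hj.1 (hj.2.trans hb))
  · rw [Finset.mem_range] at hj
    exact measurable_iff_comap_le.1 (measurable_history_noise (hj.trans_le hc))

end Measurability

/-! ### Bounds along one realization -/

section Realization

variable {d : ℕ} {D : ℝ} {η : ℕ → ℝ} {x₀ Δ₀ : EuclideanSpace ℝ (Fin d)}
  {g : ℕ → EuclideanSpace ℝ (Fin d)} {n : ℕ → Fin d → ℝ} {s : ℕ → ℝ}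

theorem abs_direction_le (hD : 0 ≤ D) (hΔ₀ : Δ₀ ∈ lpBall ⊤ 0 D) (t : ℕ) (i : Fin d) :
    |direction D η Δ₀ g n t i| ≤ D := by
  cases t with
  | zero => exact (mem_box_iff hD _).1 hΔ₀ i
  | succ t => exact (mem_box_iff hD _).1 (projBox_mem hD _) i

theorem gradMax_mono (g : ℕ → EuclideanSpace ℝ (Fin d)) (i : Fin d) :
    Monotone fun t => gradMax g t i :=
  monotone_nat_of_le_succ fun _ => le_max_left _ _

theorem gradMax_nonneg (g : ℕ → EuclideanSpace ℝ (Fin d)) (t : ℕ) (i : Fin d) :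
    0 ≤ gradMax g t i := gradMax_mono g i (Nat.zero_le t)

theorem abs_le_gradMax (g : ℕ → EuclideanSpace ℝ (Fin d)) (t : ℕ) (i : Fin d) :
    |g (t + 1) i| ≤ gradMax g (t + 1) i := le_max_right _ _

theorem gradMax_le_lpNorm_top (g : ℕ → EuclideanSpace ℝ (Fin d)) {t T : ℕ} (ht : t ≤ T)
    (i : Fin d) : gradMax g t i ≤ lpNorm ⊤ (fun j : Fin T => g (j + 1) i) := by
  have h0 : 0 ≤ lpNorm ⊤ (fun j : Fin T => g (j + 1) i) := norm_nonneg _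
  induction t with
  | zero => exact h0
  | succ t ih => exact max_le (ih (by omega)) ((lpNorm_top_le_iff _ h0).1 le_rfl ⟨t, ht⟩)

theorem abs_sign_le_one (r : ℝ) : |Real.sign r| ≤ 1 := by
  rcases Real.sign_apply_eq r with h | h | h <;> simp [h]

theorem abs_iterate_sub_queryPoint_le (hD : 0 ≤ D) (hΔ₀ : Δ₀ ∈ lpBall ⊤ 0 D) {t : ℕ}
    (hs : s (t + 1) ∈ Set.Icc (0 : ℝ) 1) (m : ℕ) (i : Fin d) :
    |iterate D η x₀ Δ₀ g n (t + 1 + m) i - queryPoint D η x₀ Δ₀ g n s (t + 1) i| ≤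
      (m + 1) * D := by
  induction m with
  | zero =>
    have h1 := abs_direction_le (η := η) (g := g) (n := n) hD hΔ₀ (t + 1) i
    have e : iterate D η x₀ Δ₀ g n (t + 1 + 0) i - queryPoint D η x₀ Δ₀ g n s (t + 1) i
        = (1 - s (t + 1)) * direction D η Δ₀ g n (t + 1) i := by
      simp only [iterate, queryPoint, PiLp.add_apply, PiLp.smul_apply, smul_eq_mul]
      ring
    rw [e, abs_mul, abs_of_nonneg (sub_nonneg.2 hs.2)]
    calc _ ≤ 1 * D := mul_le_mul (by linarith [hs.1]) h1 (abs_nonneg _) zero_le_one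
      _ = _ := by simp
  | succ m ih =>
    have h1 := abs_direction_le (η := η) (g := g) (n := n) hD hΔ₀ (t + 1 + m + 1) i
    have e : iterate D η x₀ Δ₀ g n (t + 1 + (m + 1)) i - queryPoint D η x₀ Δ₀ g n s (t + 1) i
        = (iterate D η x₀ Δ₀ g n (t + 1 + m) i - queryPoint D η x₀ Δ₀ g n s (t + 1) i)
          + direction D η Δ₀ g n (t + 1 + m + 1) i := by
      rw [← add_assoc (t + 1) m 1]
      simp only [iterate, PiLp.add_apply]
      ring
    rw [e]
    push_cast
    linarith [abs_add_le (iterate D η x₀ Δ₀ g n (t + 1 + m) i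
      - queryPoint D η x₀ Δ₀ g n s (t + 1) i) (direction D η Δ₀ g n (t + 1 + m + 1) i)]

theorem abs_queryPoint_sub_queryPoint_le (hD : 0 ≤ D) (hΔ₀ : Δ₀ ∈ lpBall ⊤ 0 D) {t t' N : ℕ}
    (htt' : t ≤ t') (hN : t' < t + N) (hs : s (t + 1) ∈ Set.Icc (0 : ℝ) 1)
    (hs' : s (t' + 1) ∈ Set.Icc (0 : ℝ) 1) (i : Fin d) :
    |queryPoint D η x₀ Δ₀ g n s (t' + 1) i - queryPoint D η x₀ Δ₀ g n s (t + 1) i| ≤ N * D := by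
  rcases htt'.eq_or_lt with rfl | hlt
  · simp only [sub_self, abs_zero]; positivity
  · obtain ⟨m, rfl⟩ := Nat.exists_eq_add_of_lt hlt
    have h1 := abs_iterate_sub_queryPoint_le (η := η) (x₀ := x₀) (g := g) (n := n) hD hΔ₀ hs m i
    have h2 := abs_direction_le (η := η) (g := g) (n := n) hD hΔ₀ (t + m + 1 + 1) i
    have e : queryPoint D η x₀ Δ₀ g n s (t + m + 1 + 1) i - queryPoint D η x₀ Δ₀ g n s (t + 1) i
        = (iterate D η x₀ Δ₀ g n (t + 1 + m) i - queryPoint D η x₀ Δ₀ g n s (t + 1) i)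
          + s (t + m + 1 + 1) * direction D η Δ₀ g n (t + m + 1 + 1) i := by
      rw [show t + 1 + m = t + m + 1 by ring, queryPoint.eq_2 _ _ _ _ _ _ _ (t + m + 1)]
      simp only [PiLp.add_apply, PiLp.smul_apply, smul_eq_mul]
      ring
    have h3 : |s (t + m + 1 + 1) * direction D η Δ₀ g n (t + m + 1 + 1) i| ≤ D := by
      rw [abs_mul, abs_of_nonneg hs'.1]
      calc _ ≤ 1 * D := mul_le_mul hs'.2 h2 (abs_nonneg _) zero_le_one
        _ = D := one_mul D
    have h4 : ((m : ℝ) + 1 + 1) * D ≤ N * D := by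
      have : ((m + 1 + 1 : ℕ) : ℝ) ≤ N := by exact_mod_cast (by omega : m + 1 + 1 ≤ N)
      push_cast at this
      gcongr
    rw [e]
    exact (abs_add_le _ _).trans (by linarith)

theorem sum_Icc_one_eq_sum_range {M : Type*} [AddCommMonoid M] (F : ℕ → M) (N : ℕ) :
    ∑ j ∈ Finset.Icc 1 N, F j = ∑ j ∈ Finset.range N, F (j + 1) := by
  induction N with
  | zero => simp
  | succ N ih => rw [Finset.sum_Icc_succ_top (by omega), ih, Finset.sum_range_succ]

/-- Within a block of `N` steps the query points stay in the open `δ`-box around their average: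
two of them differ by at most `N D = δ`, and one of the `N` differences is zero. -/
theorem abs_queryPoint_sub_blockAverage_lt (hD : 0 ≤ D) (hΔ₀ : Δ₀ ∈ lpBall ⊤ 0 D) {N k : ℕ}
    {δ : ℝ} (hδ : 0 < δ) (hND : N * D = δ)
    (hs : ∀ j < N, s ((k - 1) * N + j + 1) ∈ Set.Icc (0 : ℝ) 1) {j : ℕ}
    (hj : j < N) (i : Fin d) :
    |queryPoint D η x₀ Δ₀ g n s ((k - 1) * N + j + 1) i
      - blockAverage N (queryPoint D η x₀ Δ₀ g n s) k i| < δ := by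
  set w := queryPoint D η x₀ Δ₀ g n s
  have hN0 : (0 : ℝ) < N := by exact_mod_cast (Nat.zero_le j).trans_lt hj
  have hdist : ∀ l ∈ Finset.range N,
      |w ((k - 1) * N + j + 1) i - w ((k - 1) * N + l + 1) i| ≤ δ := by
    intro l hl
    rw [Finset.mem_range] at hl
    rw [← hND]
    rcases le_total l j with h | h
    · exact abs_queryPoint_sub_queryPoint_le hD hΔ₀ (by omega) (by omega) (hs l hl) (hs j hj) i
    · rw [abs_sub_comm]
      exact abs_queryPoint_sub_queryPoint_le hD hΔ₀ (by omega) (by omega) (hs j hj) (hs l hl) i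
  have hsum : ∑ l ∈ Finset.range N, |w ((k - 1) * N + j + 1) i - w ((k - 1) * N + l + 1) i|
      < ∑ l ∈ Finset.range N, δ :=
    Finset.sum_lt_sum hdist ⟨j, Finset.mem_range.2 hj, by simpa using hδ⟩
  have e : w ((k - 1) * N + j + 1) i - blockAverage N w k i
      = (N : ℝ)⁻¹ * ∑ l ∈ Finset.range N,
        (w ((k - 1) * N + j + 1) i - w ((k - 1) * N + l + 1) i) := by
    rw [blockAverage, sum_Icc_one_eq_sum_range, PiLp.smul_apply, WithLp.ofLp_sum, Finset.sum_apply,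
      Finset.sum_sub_distrib, Finset.sum_const, Finset.card_range, smul_eq_mul, nsmul_eq_mul,
      mul_sub, inv_mul_cancel_left₀ hN0.ne']
    rfl
  rw [e, abs_mul, abs_of_pos (inv_pos.2 hN0), inv_mul_lt_iff₀ hN0]
  calc _ ≤ _ := Finset.abs_sum_le_sum_abs _ _
    _ < _ := hsum
    _ = N * δ := by simp

end Realization

/-! ### The error of the stochastic gradients -/

/-- The loss in coordinate `i` at time `t`: the randomized sign, rescaled by the running maximum so
that it is an unbiased estimate of `g_t`. At the last time `T` no sign is drawn, and the stochastic
gradient itself is taken. -/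
noncomputable def signLoss {d : ℕ} (T : ℕ) (g : ℕ → EuclideanSpace ℝ (Fin d))
    (n : ℕ → Fin d → ℝ) (t : ℕ) (i : Fin d) : ℝ :=
  if t < T then gradMax g t i * Real.sign (g t i + gradMax g t i * n t i) else g t i

section Run

variable {Ω : Type*} {d : ℕ}
  {f : EuclideanSpace ℝ (Fin d) → ℝ} {D : ℝ} {η : ℕ → ℝ} {x₀ Δ₀ : EuclideanSpace ℝ (Fin d)} {T : ℕ}
  {g : ℕ → Ω → EuclideanSpace ℝ (Fin d)} {s : ℕ → Ω → ℝ} {n : ℕ → Ω → Fin d → ℝ} {L : Fin d → ℝ}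

theorem measurable_signLoss_history {a b c t : ℕ} (ha : t + 1 ≤ a) (hc : t + 1 < T → t + 1 < c)
    (i : Fin d) :
    Measurable[history g s n a b c] fun ω =>
      signLoss T (fun j => g j ω) (fun j => n j ω) (t + 1) i := by
  have hg : Measurable[history g s n a b c] fun ω => g (t + 1) ω i :=
    measurable_euclideanSpace_iff.1 (measurable_history_gradient (by omega) ha) i
  unfold signLoss
  split_ifs with h
  · have hG : Measurable[history g s n a b c] fun ω => gradMax (fun j => g j ω) (t + 1) i :=
      measurable_gradMax (fun j h1 h2 => measurable_history_gradient h1 h2) ha i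
    have hn : Measurable[history g s n a b c] fun ω => n (t + 1) ω i :=
      (measurable_pi_apply i).comp (measurable_history_noise (hc h))
    exact hG.mul (measurable_real_sign.comp (hg.add (hG.mul hn)))
  · exact hg

theorem measurable_gradient_queryPoint_history (hη : η 0 = 0) {a b c t : ℕ} (ha : t ≤ a)
    (hb : t + 1 ≤ b) (hc : t + 1 ≤ c) (i : Fin d) :
    Measurable[history g s n a b c] fun ω => gradient f (queryPoint D η x₀ Δ₀ (fun j => g j ω)
      (fun j => n j ω) (fun j => s j ω) (t + 1)) i :=
  measurable_euclideanSpace_iff.1 ((measurable_gradient f).comp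
    (measurable_queryPoint (fun _ h1 h2 => measurable_history_gradient h1 h2)
      (fun _ h1 h2 => measurable_history_scaling h1 h2) (fun _ h => measurable_history_noise h)
      hη ha hb hc)) i

theorem measurable_direction_history (hη : η 0 = 0) {a b c t : ℕ} (ha : t ≤ a + 1)
    (hc : t ≤ c) :
    Measurable[history g s n a b c] fun ω => direction D η Δ₀ (fun j => g j ω)
      (fun j => n j ω) t :=
  measurable_direction (fun _ h1 h2 => measurable_history_gradient h1 h2)
    (fun _ h => measurable_history_noise h) hη ha hc

variable [MeasurableSpace Ω] {μ : Measure Ω}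

theorem abs_signLoss_le (g : ℕ → EuclideanSpace ℝ (Fin d)) (n : ℕ → Fin d → ℝ) (t : ℕ)
    (i : Fin d) : |signLoss T g n (t + 1) i| ≤ gradMax g (t + 1) i := by
  unfold signLoss
  split_ifs
  · rw [abs_mul, abs_of_nonneg (gradMax_nonneg _ _ _)]
    exact mul_le_of_le_one_right (gradMax_nonneg _ _ _) (abs_sign_le_one _)
  · exact abs_le_gradMax _ _ _

namespace IsRun

theorem history_le (hrun : IsRun μ f D η x₀ Δ₀ T g s n) {a b c : ℕ} (ha : a ≤ T) (hb : b ≤ T)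
    (hc : c ≤ T) : history g s n a b c ≤ ‹MeasurableSpace Ω› := by
  refine sup_le (sup_le (iSup₂_le fun j hj => ?_) (iSup₂_le fun j hj => ?_))
    (iSup₂_le fun j hj => ?_)
  · obtain ⟨h1, h2⟩ := Finset.mem_Icc.1 hj
    obtain ⟨t, rfl⟩ := Nat.exists_eq_add_of_le' h1
    exact measurable_iff_comap_le.1 (hrun.measurable_g t (by omega))
  · obtain ⟨h1, h2⟩ := Finset.mem_Icc.1 hj
    obtain ⟨t, rfl⟩ := Nat.exists_eq_add_of_le' h1
    exact measurable_iff_comap_le.1 (hrun.measurable_s t (by omega))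
  · exact measurable_iff_comap_le.1 (hrun.measurable_n j ((Finset.mem_range.1 hj).trans_le hc))

theorem memLp_gradMax (hrun : IsRun μ f D η x₀ Δ₀ T g s n) (hlip : CoordLipschitz μ T g L) {t : ℕ}
    (ht : t ≤ T) (i : Fin d) : MemLp (fun ω => gradMax (fun j => g j ω) t i) 2 μ := by
  have hmeas : Measurable fun ω => gradMax (fun j => g j ω) t i :=
    (measurable_gradMax (a := T) (fun j h1 h2 => by
      obtain ⟨l, rfl⟩ := Nat.exists_eq_add_of_le' h1
      exact hrun.measurable_g l h2) ht i)
  refine (memLp_two_iff_integrable_sq hmeas.aestronglyMeasurable).2 ?_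
  refine (hlip.integrable i).mono' (hmeas.pow_const 2).aestronglyMeasurable
    (Filter.Eventually.of_forall fun ω => ?_)
  rw [Real.norm_eq_abs, abs_of_nonneg (sq_nonneg _)]
  exact pow_le_pow_left₀ (gradMax_nonneg _ _ _) (gradMax_le_lpNorm_top _ ht i) 2

theorem integral_sq_gradMax_le (hlip : CoordLipschitz μ T g L) {t : ℕ}
    (ht : t ≤ T) (i : Fin d) : ∫ ω, gradMax (fun j => g j ω) t i ^ 2 ∂μ ≤ L i ^ 2 := by
  refine le_trans ?_ (hlip.bound i)
  refine integral_mono_of_nonneg (Filter.Eventually.of_forall fun ω => sq_nonneg _)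
    (hlip.integrable i) (Filter.Eventually.of_forall fun ω => ?_)
  exact pow_le_pow_left₀ (gradMax_nonneg _ _ _) (gradMax_le_lpNorm_top _ ht i) 2

theorem memLp_signLoss (hrun : IsRun μ f D η x₀ Δ₀ T g s n) (hlip : CoordLipschitz μ T g L) {t : ℕ}
    (ht : t < T) (i : Fin d) :
    MemLp (fun ω => signLoss T (fun j => g j ω) (fun j => n j ω) (t + 1) i) 2 μ := by
  refine (hrun.memLp_gradMax hlip ht i).mono ?_ (Filter.Eventually.of_forall fun ω => ?_)
  · exact ((measurable_signLoss_history (b := T) (c := T) ht (fun h => h) i).mono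
      (hrun.history_le le_rfl le_rfl le_rfl) le_rfl).aestronglyMeasurable
  · rw [Real.norm_eq_abs, Real.norm_eq_abs, abs_of_nonneg (gradMax_nonneg _ _ _)]
    exact abs_signLoss_le _ _ _ _

theorem memLp_stochasticGradient (hrun : IsRun μ f D η x₀ Δ₀ T g s n)
    (hlip : CoordLipschitz μ T g L) {t : ℕ} (ht : t < T) (i : Fin d) :
    MemLp (fun ω => g (t + 1) ω i) 2 μ := by
  refine (hrun.memLp_gradMax hlip ht i).mono
    (measurable_euclideanSpace_iff.1 (hrun.measurable_g t ht) i).aestronglyMeasurable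
    (Filter.Eventually.of_forall fun ω => ?_)
  rw [Real.norm_eq_abs, Real.norm_eq_abs, abs_of_nonneg (gradMax_nonneg _ _ _)]
  exact abs_le_gradMax (fun j => g j ω) _ _

theorem integral_gradMax_le [IsProbabilityMeasure μ] (hrun : IsRun μ f D η x₀ Δ₀ T g s n)
    (hlip : CoordLipschitz μ T g L) {t : ℕ} (ht : t ≤ T) (i : Fin d) :
    ∫ ω, gradMax (fun j => g j ω) t i ∂μ ≤ L i := by
  have hvar := variance_nonneg (fun ω => gradMax (fun j => g j ω) t i) μ
  rw [variance_eq_sub (hrun.memLp_gradMax hlip ht i)] at hvar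
  have h1 := integral_sq_gradMax_le hlip ht i
  simp only [Pi.pow_apply] at hvar
  exact le_of_sq_le_sq (by linarith) (hlip.nonneg i)

theorem memLp_gradient_queryPoint (hrun : IsRun μ f D η x₀ Δ₀ T g s n)
    (hlip : CoordLipschitz μ T g L) {t : ℕ} (ht : t < T) (i : Fin d) :
    MemLp (fun ω => gradient f (queryPoint D η x₀ Δ₀ (fun j => g j ω) (fun j => n j ω)
      (fun j => s j ω) (t + 1)) i) 2 μ :=
  (memLp_congr_ae (hrun.unbiased t ht i)).1
    ((hrun.memLp_stochasticGradient hlip ht i).condExp one_le_two)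

variable [IsProbabilityMeasure μ]

theorem integral_stochasticGradient_mul (hrun : IsRun μ f D η x₀ Δ₀ T g s n)
    (hlip : CoordLipschitz μ T g L) {t : ℕ} (ht : t < T) (i : Fin d) {V : Ω → ℝ}
    (hV : Measurable[history g s n t (t + 1) (t + 1)] V) (hV2 : MemLp V 2 μ) :
    ∫ ω, g (t + 1) ω i * V ω ∂μ =
      ∫ ω, gradient f (queryPoint D η x₀ Δ₀ (fun j => g j ω) (fun j => n j ω)
        (fun j => s j ω) (t + 1)) i * V ω ∂μ := by
  have hle : history g s n t (t + 1) (t + 1) ≤ ‹MeasurableSpace Ω› :=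
    hrun.history_le ht.le ht ht
  have hg := hrun.memLp_stochasticGradient hlip ht i
  have h1 := condExp_mul_of_stronglyMeasurable_right (μ := μ) hV.stronglyMeasurable
    (hg.integrable_mul hV2) (hg.integrable one_le_two)
  -- pull `V` out of the conditional expectation
  rw [← integral_condExp hle]
  refine integral_congr_ae ?_
  filter_upwards [h1, hrun.unbiased t ht i] with ω h2 h3
  exact h2.trans (congrArg (· * V ω) h3)

/-- Averaging over the sign noise turns the loss into the stochastic gradient. -/
theorem integral_signLoss_mul (hrun : IsRun μ f D η x₀ Δ₀ T g s n)
    (hlip : CoordLipschitz μ T g L) {t : ℕ} (ht : t < T) (i : Fin d) {V : Ω → ℝ}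
    (hV : Measurable[history g s n (t + 1) (t + 1) (t + 1)] V) (hV2 : MemLp V 2 μ) :
    ∫ ω, signLoss T (fun j => g j ω) (fun j => n j ω) (t + 1) i * V ω ∂μ =
      ∫ ω, g (t + 1) ω i * V ω ∂μ := by
  have hint := (hrun.memLp_signLoss hlip ht i).integrable_mul hV2
  unfold signLoss at hint ⊢
  split_ifs at hint ⊢ with h
  · have hX : Measurable[history g s n (t + 1) (t + 1) (t + 1)]
        fun ω => ((g (t + 1) ω i, gradMax (fun j => g j ω) (t + 1) i), V ω) :=
      ((measurable_euclideanSpace_iff.1 (measurable_history_gradient (by omega) le_rfl) i).prodMk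
        (measurable_gradMax (fun j h1 h2 => measurable_history_gradient h1 h2) le_rfl i)).prodMk hV
    have hni : Measurable fun ω => n (t + 1) ω i := measurable_pi_iff.1 (hrun.measurable_n _ h) i
    have hindep : Indep (MeasurableSpace.comap (fun ω => n (t + 1) ω i) inferInstance)
        (history g s n (t + 1) (t + 1) (t + 1)) μ := by
      refine indep_of_indep_of_le_left (hrun.noise_indep (t + 1) h) ?_
      exact measurable_iff_comap_le.1 ((measurable_pi_apply i).comp (comap_measurable _))
    have hφ : Measurable fun z : ((ℝ × ℝ) × ℝ) × ℝ =>
        z.1.1.2 * Real.sign (z.1.1.1 + z.1.1.2 * z.2) * z.1.2 :=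
      (measurable_fst.fst.snd.mul (measurable_real_sign.comp
        (measurable_fst.fst.fst.add (measurable_fst.fst.snd.mul measurable_snd)))).mul
        measurable_fst.snd
    have hfub := (integral_comp_indep (hrun.history_le ht ht ht) hX hni hindep hφ hint).2
    refine hfub.trans (integral_congr_ae (Filter.Eventually.of_forall fun ω => ?_))
    simp only
    rw [integral_mul_const, integral_comp_of_isUniform_Icc (by norm_num)
      (isUniform_apply_of_isUniform_Icc (hrun.measurable_n _ h) (hrun.noise_uniform _ h) i)
      (fun r => gradMax (fun j => g j ω) (t + 1) i *
        Real.sign (g (t + 1) ω i + gradMax (fun j => g j ω) (t + 1) i * r)),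
      integral_sign_add_mul (abs_le_gradMax (fun j => g j ω) t i)]
    ring
  · rfl

/-- The deviation of the losses from the gradients at the query points is uncorrelated with
everything known when the stochastic gradient is queried. -/
theorem integral_signLoss_sub_gradient_mul (hrun : IsRun μ f D η x₀ Δ₀ T g s n)
    (hlip : CoordLipschitz μ T g L) {t : ℕ} (ht : t < T) (i : Fin d) {V : Ω → ℝ}
    (hV : Measurable[history g s n t (t + 1) (t + 1)] V) (hV2 : MemLp V 2 μ) :
    ∫ ω, (signLoss T (fun j => g j ω) (fun j => n j ω) (t + 1) i -
      gradient f (queryPoint D η x₀ Δ₀ (fun j => g j ω) (fun j => n j ω)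
        (fun j => s j ω) (t + 1)) i) * V ω ∂μ = 0 := by
  have i1 : Integrable (fun ω => signLoss T (fun j => g j ω) (fun j => n j ω) (t + 1) i * V ω) μ :=
    (hrun.memLp_signLoss hlip ht i).integrable_mul hV2
  have i2 : Integrable (fun ω => gradient f (queryPoint D η x₀ Δ₀ (fun j => g j ω)
      (fun j => n j ω) (fun j => s j ω) (t + 1)) i * V ω) μ :=
    (hrun.memLp_gradient_queryPoint hlip ht i).integrable_mul hV2
  simp only [sub_mul]
  rw [integral_sub i1 i2, hrun.integral_signLoss_mul hlip ht i
    (hV.mono (history_mono (Nat.le_succ t) le_rfl le_rfl) le_rfl) hV2,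
    hrun.integral_stochasticGradient_mul hlip ht i hV hV2, sub_self]

theorem integral_sq_signLoss_sub_gradient_le (hrun : IsRun μ f D η x₀ Δ₀ T g s n) (hη : η 0 = 0)
    (hlip : CoordLipschitz μ T g L) {t : ℕ} (ht : t < T) (i : Fin d) :
    ∫ ω, (signLoss T (fun j => g j ω) (fun j => n j ω) (t + 1) i -
      gradient f (queryPoint D η x₀ Δ₀ (fun j => g j ω) (fun j => n j ω)
        (fun j => s j ω) (t + 1)) i) ^ 2 ∂μ ≤ L i ^ 2 := by
  set h : Ω → ℝ := fun ω => signLoss T (fun j => g j ω) (fun j => n j ω) (t + 1) i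
  set p : Ω → ℝ := fun ω => gradient f (queryPoint D η x₀ Δ₀ (fun j => g j ω) (fun j => n j ω)
        (fun j => s j ω) (t + 1)) i
  have hh : MemLp h 2 μ := hrun.memLp_signLoss hlip ht i
  have hp : MemLp p 2 μ := hrun.memLp_gradient_queryPoint hlip ht i
  have horth : ∫ ω, (h ω - p ω) * p ω ∂μ = 0 :=
    hrun.integral_signLoss_sub_gradient_mul hlip ht i
      (measurable_gradient_queryPoint_history hη le_rfl le_rfl le_rfl i) hp
  have e : ∀ ω, (h ω - p ω) ^ 2 = h ω ^ 2 - p ω ^ 2 - 2 * ((h ω - p ω) * p ω) := fun ω => by ring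
  have i1 : Integrable (fun ω => h ω ^ 2 - p ω ^ 2) μ := hh.integrable_sq.sub hp.integrable_sq
  have i2 : Integrable (fun ω => (h ω - p ω) * p ω) μ := (hh.sub hp).integrable_mul hp
  change ∫ ω, (h ω - p ω) ^ 2 ∂μ ≤ L i ^ 2
  simp only [e]
  rw [integral_sub i1 (i2.const_mul 2), integral_const_mul, horth,
    integral_sub hh.integrable_sq hp.integrable_sq]
  have h1 : ∫ ω, h ω ^ 2 ∂μ ≤ L i ^ 2 := by
    refine le_trans (integral_mono hh.integrable_sq
      (hrun.memLp_gradMax hlip ht i).integrable_sq fun ω => ?_) (integral_sq_gradMax_le hlip ht i)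
    exact sq_le_sq.2 ((abs_signLoss_le _ _ _ _).trans (le_abs_self _))
  have h2 : 0 ≤ ∫ ω, p ω ^ 2 ∂μ := integral_nonneg fun ω => sq_nonneg _
  linarith

end IsRun
end Run

/-! ### Bounds for one block, for the descent, and for all blocks -/

section Blocks

variable {Ω : Type*} {d : ℕ}
  {f : EuclideanSpace ℝ (Fin d) → ℝ} {D : ℝ} {η : ℕ → ℝ} {x₀ Δ₀ : EuclideanSpace ℝ (Fin d)} {T : ℕ}
  {g : ℕ → Ω → EuclideanSpace ℝ (Fin d)} {s : ℕ → Ω → ℝ} {n : ℕ → Ω → Fin d → ℝ} {L : Fin d → ℝ}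

theorem stepSize_zero (D : ℝ) (N : ℕ) : stepSize D N 0 = 0 := if_pos rfl

theorem stepSize_succ (D : ℝ) (N t : ℕ) : stepSize D N (t + 1) = 2 * D / Real.sqrt N :=
  if_neg (Nat.succ_ne_zero t)

theorem sign_mul_self_eq_abs (r : ℝ) : Real.sign r * r = |r| := by
  rcases lt_trichotomy r 0 with h | rfl | h
  · rw [Real.sign_of_neg h, abs_of_neg h]; ring
  · simp
  · rw [Real.sign_of_pos h, abs_of_pos h]; ring

theorem block_regret_le (hD : 0 < D) (hΔ₀ : Δ₀ ∈ lpBall ⊤ 0 D) {N : ℕ} (hN : 0 < N)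
    (g : ℕ → EuclideanSpace ℝ (Fin d)) (n : ℕ → Fin d → ℝ) {a : ℕ} (ha : a + N ≤ T) (i : Fin d)
    {u : ℝ} (hu : |u| ≤ D) :
    ∑ j ∈ Finset.range N, signLoss T g n (a + j + 1) i *
      (direction D (stepSize D N) Δ₀ g n (a + j + 1) i - u) ≤
        2 * D * Real.sqrt N * gradMax g T i := by
  obtain ⟨m, rfl⟩ := Nat.exists_eq_add_of_le' hN
  have hsqrt : 0 < Real.sqrt ((m + 1 : ℕ) : ℝ) := Real.sqrt_pos.2 (by positivity)
  have hη : 0 < 2 * D / Real.sqrt ((m + 1 : ℕ) : ℝ) := by positivity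
  have h := sign_regret_le (m := m) hη hD.le hu (G := fun j => gradMax g (a + j + 1) i)
    (h := fun j => signLoss T g n (a + j + 1) i)
    (z := fun j => direction D (stepSize D (m + 1)) Δ₀ g n (a + j + 1) i)
    (fun j => gradMax_nonneg _ _ _)
    (fun j l hjl => gradMax_mono g i (by omega))
    (fun j => abs_direction_le hD.le hΔ₀ _ _) (abs_signLoss_le _ _ _ _)
    (fun j hj => ⟨_, abs_sign_le_one _, if_pos (by omega), by
      change direction D (stepSize D (m + 1)) Δ₀ g n (a + j + 1 + 1) i = _
      rw [direction, stepSize_succ]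
      rfl⟩)
  refine h.trans ?_
  have e : 2 * D ^ 2 / (2 * D / Real.sqrt ((m + 1 : ℕ) : ℝ))
      + 2 * D / Real.sqrt ((m + 1 : ℕ) : ℝ) * (m + 1) / 2
      = 2 * D * Real.sqrt ((m + 1 : ℕ) : ℝ) := by
    have h1 : (m : ℝ) + 1 = Real.sqrt ((m + 1 : ℕ) : ℝ) ^ 2 := by
      rw [Real.sq_sqrt (Nat.cast_nonneg _)]; push_cast; rfl
    rw [h1]
    field_simp
    ring
  rw [e, mul_comm]
  exact mul_le_mul_of_nonneg_left (gradMax_mono g i (by omega)) (by positivity)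

variable [MeasurableSpace Ω] {μ : Measure Ω} [IsProbabilityMeasure μ]

namespace IsRun

theorem memLp_direction (hrun : IsRun μ f D η x₀ Δ₀ T g s n) (hη : η 0 = 0) (hD : 0 ≤ D)
    (hΔ₀ : Δ₀ ∈ lpBall ⊤ 0 D) {t : ℕ} (ht : t < T) (i : Fin d) (p : ℝ≥0∞) :
    MemLp (fun ω => direction D η Δ₀ (fun j => g j ω) (fun j => n j ω) (t + 1) i) p μ := by
  refine MemLp.of_bound ?_ D (Filter.Eventually.of_forall fun ω => abs_direction_le hD hΔ₀ _ _)
  exact (measurable_euclideanSpace_iff.1 ((measurable_direction_history hη (a := T) (b := T)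
    (c := T) (by omega) ht).mono (hrun.history_le le_rfl le_rfl le_rfl) le_rfl) i).aestronglyMeasurable

/-- The sum of the gradients over one block. The best direction in hindsight has inner product
`-D |∑ p|` with it, which the regret bound transfers to the directions chosen. -/
theorem block_gradient_le {N : ℕ} (hrun : IsRun μ f D (stepSize D N) x₀ Δ₀ T g s n)
    (hlip : CoordLipschitz μ T g L) (hD : 0 < D) (hΔ₀ : Δ₀ ∈ lpBall ⊤ 0 D) (hN : 0 < N) {a : ℕ}
    (ha : a + N ≤ T) (i : Fin d) :
    D * ∫ ω, |∑ j ∈ Finset.range N, gradient f (queryPoint D (stepSize D N) x₀ Δ₀ (fun j => g j ω)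
        (fun j => n j ω) (fun j => s j ω) (a + j + 1)) i| ∂μ ≤
      3 * D * Real.sqrt N * L i - ∑ j ∈ Finset.range N,
        ∫ ω, gradient f (queryPoint D (stepSize D N) x₀ Δ₀ (fun j => g j ω)
          (fun j => n j ω) (fun j => s j ω) (a + j + 1)) i *
          direction D (stepSize D N) Δ₀ (fun j => g j ω) (fun j => n j ω) (a + j + 1) i ∂μ := by
  have hη := stepSize_zero D N
  set p : ℕ → Ω → ℝ := fun j ω => gradient f (queryPoint D (stepSize D N) x₀ Δ₀ (fun j => g j ω)
    (fun j => n j ω) (fun j => s j ω) (a + j + 1)) i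
  set z : ℕ → Ω → ℝ := fun j ω => direction D (stepSize D N) Δ₀ (fun j => g j ω)
    (fun j => n j ω) (a + j + 1) i
  set h : ℕ → Ω → ℝ := fun j ω => signLoss T (fun j => g j ω) (fun j => n j ω) (a + j + 1) i
  set G : Ω → ℝ := fun ω => gradMax (fun j => g j ω) T i
  have hpL : ∀ j < N, MemLp (p j) 2 μ := fun j hj =>
    hrun.memLp_gradient_queryPoint hlip (by omega) i
  have hhL : ∀ j < N, MemLp (h j) 2 μ := fun j hj => hrun.memLp_signLoss hlip (by omega) i
  have hzL : ∀ j < N, MemLp (z j) 2 μ := fun j hj =>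
    hrun.memLp_direction hη hD.le hΔ₀ (by omega) i 2
  have hGL : Integrable G μ := (hrun.memLp_gradMax hlip le_rfl i).integrable one_le_two
  have hξL : ∀ j < N, MemLp (fun ω => h j ω - p j ω) 2 μ := fun j hj => (hhL j hj).sub (hpL j hj)
  have hnoise : ∫ ω, |∑ j ∈ Finset.range N, (h j ω - p j ω)| ∂μ ≤ Real.sqrt N * L i := by
    refine integral_abs_sum_range_le (hlip.nonneg i) hξL (fun j hj => ?_)
      (fun j hj => hrun.integral_sq_signLoss_sub_gradient_le hη hlip (by omega) i)
    simp only [mul_comm (∑ l ∈ Finset.range j, _)]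
    refine hrun.integral_signLoss_sub_gradient_mul hlip (by omega) i
      (Finset.measurable_fun_sum _ fun l hl => ?_)
      (memLp_finsetSum _ fun l hl => hξL l ((Finset.mem_range.1 hl).trans hj))
    have hl' := Finset.mem_range.1 hl
    exact (measurable_signLoss_history (by omega) (by omega) i).sub
      (measurable_gradient_queryPoint_history hη (by omega) (by omega) (by omega) i)
  have hcross : ∀ j < N, ∫ ω, (h j ω - p j ω) * z j ω ∂μ = 0 := fun j hj =>
    hrun.integral_signLoss_sub_gradient_mul hlip (by omega) i
      (measurable_euclideanSpace_iff.1 (measurable_direction_history hη (by omega) (by omega)) i)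
      (hzL j hj)
  -- the regret bound against the hindsight comparator, along every realization
  have hpoint : ∀ ω, D * |∑ j ∈ Finset.range N, p j ω| ≤
      2 * D * Real.sqrt N * G ω + D * |∑ j ∈ Finset.range N, (h j ω - p j ω)|
        - (∑ j ∈ Finset.range N, (h j ω - p j ω) * z j ω)
        - ∑ j ∈ Finset.range N, p j ω * z j ω := by
    intro ω
    -- the comparator that is best in hindsight for the true gradients
    set u : ℝ := -D * Real.sign (∑ j ∈ Finset.range N, p j ω) with hu
    have huD : |u| ≤ D := by
      rw [hu, abs_mul, abs_neg, abs_of_pos hD]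
      exact mul_le_of_le_one_right hD.le (abs_sign_le_one _)
    have h1 := block_regret_le hD hΔ₀ hN (fun j => g j ω) (fun j => n j ω) ha i huD
    have h2 : D * |∑ j ∈ Finset.range N, p j ω| = -(u * ∑ j ∈ Finset.range N, p j ω) := by
      rw [hu, ← sign_mul_self_eq_abs]; ring
    have h3 : u * ∑ j ∈ Finset.range N, (h j ω - p j ω)
        ≤ D * |∑ j ∈ Finset.range N, (h j ω - p j ω)| := by
      refine (le_abs_self _).trans ?_
      rw [abs_mul]
      exact mul_le_mul_of_nonneg_right huD (abs_nonneg _)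
    have h4 : ∑ j ∈ Finset.range N, h j ω * (z j ω - u) =
        (∑ j ∈ Finset.range N, (h j ω - p j ω) * z j ω) + (∑ j ∈ Finset.range N, p j ω * z j ω)
        - u * (∑ j ∈ Finset.range N, (h j ω - p j ω)) - u * ∑ j ∈ Finset.range N, p j ω := by
      rw [Finset.mul_sum, Finset.mul_sum, ← Finset.sum_add_distrib, ← Finset.sum_sub_distrib,
        ← Finset.sum_sub_distrib]
      exact Finset.sum_congr rfl fun j _ => by ring
    change ∑ j ∈ Finset.range N, h j ω * (z j ω - u) ≤ _ at h1
    change _ ≤ 2 * D * Real.sqrt N * gradMax (fun j => g j ω) T i + _ - _ - _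
    linarith
  have iP : Integrable (fun ω => |∑ j ∈ Finset.range N, p j ω|) μ :=
    (integrable_finsetSum _ fun j hj =>
      (hpL j (Finset.mem_range.1 hj)).integrable one_le_two).abs
  have iξ : Integrable (fun ω => |∑ j ∈ Finset.range N, (h j ω - p j ω)|) μ :=
    (integrable_finsetSum _ fun j hj =>
      (hξL j (Finset.mem_range.1 hj)).integrable one_le_two).abs
  have iξz : ∀ j ∈ Finset.range N, Integrable (fun ω => (h j ω - p j ω) * z j ω) μ := fun j hj =>
    (hξL j (Finset.mem_range.1 hj)).integrable_mul (hzL j (Finset.mem_range.1 hj))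
  have ipz : ∀ j ∈ Finset.range N, Integrable (fun ω => p j ω * z j ω) μ := fun j hj =>
    (hpL j (Finset.mem_range.1 hj)).integrable_mul (hzL j (Finset.mem_range.1 hj))
  have i1 : Integrable (fun ω => 2 * D * Real.sqrt N * G ω) μ := hGL.const_mul _
  have i2 : Integrable (fun ω => D * |∑ j ∈ Finset.range N, (h j ω - p j ω)|) μ := iξ.const_mul _
  have i3 := integrable_finsetSum _ iξz
  have i4 := integrable_finsetSum _ ipz
  have i12 : Integrable (fun ω => 2 * D * Real.sqrt N * G ω
      + D * |∑ j ∈ Finset.range N, (h j ω - p j ω)|) μ := i1.add i2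
  have i123 : Integrable (fun ω => 2 * D * Real.sqrt N * G ω
      + D * |∑ j ∈ Finset.range N, (h j ω - p j ω)|
      - ∑ j ∈ Finset.range N, (h j ω - p j ω) * z j ω) μ := i12.sub i3
  have hmono := integral_mono (iP.const_mul D) (i123.sub i4) hpoint
  have e : ∫ ω, (2 * D * Real.sqrt N * G ω + D * |∑ j ∈ Finset.range N, (h j ω - p j ω)|
        - (∑ j ∈ Finset.range N, (h j ω - p j ω) * z j ω)
        - ∑ j ∈ Finset.range N, p j ω * z j ω) ∂μ
      = 2 * D * Real.sqrt N * (∫ ω, G ω ∂μ)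
        + D * (∫ ω, |∑ j ∈ Finset.range N, (h j ω - p j ω)| ∂μ)
        - ∑ j ∈ Finset.range N, ∫ ω, p j ω * z j ω ∂μ := by
    rw [integral_sub i123 i4, integral_sub i12 i3, integral_add i1 i2, integral_const_mul,
      integral_const_mul, integral_finsetSum _ iξz, integral_finsetSum _ ipz,
      Finset.sum_eq_zero fun j hj => hcross j (Finset.mem_range.1 hj), sub_zero]
  rw [integral_const_mul] at hmono
  refine hmono.trans (e.le.trans ?_)
  have h5 := mul_le_mul_of_nonneg_left (hrun.integral_gradMax_le hlip le_rfl i)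
    (by positivity : 0 ≤ 2 * D * Real.sqrt N)
  have h6 := mul_le_mul_of_nonneg_left hnoise hD.le
  have h7 : 3 * D * Real.sqrt N * L i = 2 * D * Real.sqrt N * L i + D * (Real.sqrt N * L i) := by
    ring
  rw [h7]
  exact sub_le_sub_right (add_le_add h5 h6) _

/-- The expected decrease of `f` in one step: by the fundamental theorem of calculus, the random
scaling makes `⟪∇f (w_t), Δ_t⟫` an unbiased estimate of `f (x_t) - f (x_{t-1})`. -/
theorem integral_inner_gradient_direction (hrun : IsRun μ f D η x₀ Δ₀ T g s n) (hη : η 0 = 0)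
    (hlip : CoordLipschitz μ T g L) (hD : 0 ≤ D) (hΔ₀ : Δ₀ ∈ lpBall ⊤ 0 D)
    (hwell : WellBehaved f) {t : ℕ} (ht : t < T) :
    Integrable (fun ω => f (iterate D η x₀ Δ₀ (fun j => g j ω) (fun j => n j ω) (t + 1))
        - f (iterate D η x₀ Δ₀ (fun j => g j ω) (fun j => n j ω) t)) μ ∧
      ∑ i, ∫ ω, gradient f (queryPoint D η x₀ Δ₀ (fun j => g j ω) (fun j => n j ω)
          (fun j => s j ω) (t + 1)) i *
          direction D η Δ₀ (fun j => g j ω) (fun j => n j ω) (t + 1) i ∂μ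
        = ∫ ω, (f (iterate D η x₀ Δ₀ (fun j => g j ω) (fun j => n j ω) (t + 1))
          - f (iterate D η x₀ Δ₀ (fun j => g j ω) (fun j => n j ω) t)) ∂μ := by
  have hterm : ∀ i ∈ Finset.univ, Integrable (fun ω => gradient f (queryPoint D η x₀ Δ₀
      (fun j => g j ω) (fun j => n j ω) (fun j => s j ω) (t + 1)) i *
      direction D η Δ₀ (fun j => g j ω) (fun j => n j ω) (t + 1) i) μ := fun i _ =>
    (hrun.memLp_gradient_queryPoint hlip ht i).integrable_mul
      (hrun.memLp_direction hη hD hΔ₀ ht i 2)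
  have hinner : ∀ ω, ∑ i, gradient f (queryPoint D η x₀ Δ₀
      (fun j => g j ω) (fun j => n j ω) (fun j => s j ω) (t + 1)) i *
      direction D η Δ₀ (fun j => g j ω) (fun j => n j ω) (t + 1) i
      = inner ℝ (gradient f (iterate D η x₀ Δ₀ (fun j => g j ω) (fun j => n j ω) t +
          s (t + 1) ω • direction D η Δ₀ (fun j => g j ω) (fun j => n j ω) (t + 1)))
        (direction D η Δ₀ (fun j => g j ω) (fun j => n j ω) (t + 1)) := fun ω => by
    rw [PiLp.inner_apply]
    exact Finset.sum_congr rfl fun i _ => mul_comm _ _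
  have hint := integrable_finsetSum _ hterm
  rw [← integral_finsetSum _ hterm]
  simp only [hinner] at hint ⊢
  have hX : Measurable[history g s n t t (t + 1)] fun ω =>
      (iterate D η x₀ Δ₀ (fun j => g j ω) (fun j => n j ω) t,
        direction D η Δ₀ (fun j => g j ω) (fun j => n j ω) (t + 1)) :=
    (measurable_iterate (a := t) (c := t + 1) (fun j h1 h2 => measurable_history_gradient h1 h2)
      (fun j h => measurable_history_noise h) hη (by omega) (by omega)).prodMk
      (measurable_direction_history hη le_rfl le_rfl)
  have hφ : Measurable fun z : (EuclideanSpace ℝ (Fin d) × EuclideanSpace ℝ (Fin d)) × ℝ =>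
      inner ℝ (gradient f (z.1.1 + z.2 • z.1.2)) z.1.2 :=
    ((measurable_gradient f).comp (measurable_fst.fst.add
      (measurable_snd.smul measurable_fst.snd))).inner measurable_fst.snd
  have hfub := integral_comp_indep (hrun.history_le ht.le ht.le ht) hX (hrun.measurable_s t ht)
    (hrun.scaling_indep t ht) hφ hint
  have hftc : ∀ ω, ∫ r, inner ℝ (gradient f (iterate D η x₀ Δ₀ (fun j => g j ω)
      (fun j => n j ω) t + r • direction D η Δ₀ (fun j => g j ω) (fun j => n j ω) (t + 1)))
        (direction D η Δ₀ (fun j => g j ω) (fun j => n j ω) (t + 1)) ∂(μ.map (s (t + 1)))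
      = f (iterate D η x₀ Δ₀ (fun j => g j ω) (fun j => n j ω) (t + 1))
        - f (iterate D η x₀ Δ₀ (fun j => g j ω) (fun j => n j ω) t) := fun ω => by
    rw [integral_comp_of_isUniform_Icc zero_lt_one (hrun.scaling_uniform t ht), hwell.ftc, iterate]
    simp
  simp only [hftc] at hfub
  exact hfub

/-- The expected decreases of all steps telescope, and their sum is at most `f x₀ - inf f`. -/
theorem neg_sum_integral_inner_le (hrun : IsRun μ f D η x₀ Δ₀ T g s n) (hη : η 0 = 0)
    (hlip : CoordLipschitz μ T g L) (hD : 0 ≤ D) (hΔ₀ : Δ₀ ∈ lpBall ⊤ 0 D)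
    (hwell : WellBehaved f) (hbdd : BddBelow (Set.range f)) :
    -∑ t ∈ Finset.range T, ∑ i, ∫ ω, gradient f (queryPoint D η x₀ Δ₀ (fun j => g j ω)
        (fun j => n j ω) (fun j => s j ω) (t + 1)) i *
        direction D η Δ₀ (fun j => g j ω) (fun j => n j ω) (t + 1) i ∂μ ≤ f x₀ - ⨅ x, f x := by
  have hstep := fun t (ht : t ∈ Finset.range T) =>
    hrun.integral_inner_gradient_direction hη hlip hD hΔ₀ hwell (Finset.mem_range.1 ht)
  rw [Finset.sum_congr rfl fun t ht => (hstep t ht).2,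
    ← integral_finsetSum _ fun t ht => (hstep t ht).1, ← integral_neg]
  have hle : ∀ ω, -∑ t ∈ Finset.range T,
      (f (iterate D η x₀ Δ₀ (fun j => g j ω) (fun j => n j ω) (t + 1))
        - f (iterate D η x₀ Δ₀ (fun j => g j ω) (fun j => n j ω) t)) ≤ f x₀ - ⨅ x, f x := fun ω => by
    rw [Finset.sum_range_sub fun t => f (iterate D η x₀ Δ₀ (fun j => g j ω) (fun j => n j ω) t),
      neg_sub]
    exact sub_le_sub_left (ciInf_le hbdd _) _
  calc _ ≤ ∫ _, (f x₀ - ⨅ x, f x) ∂μ :=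
        integral_mono (integrable_finsetSum _ fun t ht => (hstep t ht).1).neg
          (integrable_const _) hle
    _ = _ := by simp

theorem sum_range_mul_eq_sum_sum (F : ℕ → ℝ) (K N : ℕ) :
    ∑ t ∈ Finset.range (K * N), F t
      = ∑ k ∈ Finset.range K, ∑ j ∈ Finset.range N, F (k * N + j) := by
  induction K with
  | zero => simp
  | succ K ih => rw [Nat.succ_mul, Finset.sum_range_add, ih, Finset.sum_range_succ]

/-- The gradients, averaged over blocks, are small on average over the blocks. -/
theorem sum_block_gradient_le {K N : ℕ}
    (hrun : IsRun μ f D (stepSize D N) x₀ Δ₀ (K * N) g s n)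
    (hlip : CoordLipschitz μ (K * N) g L) (hD : 0 < D) (hΔ₀ : Δ₀ ∈ lpBall ⊤ 0 D) (hN : 0 < N)
    (hwell : WellBehaved f) (hbdd : BddBelow (Set.range f)) :
    D * ∑ k ∈ Finset.range K, ∑ i, ∫ ω, |∑ j ∈ Finset.range N,
        gradient f (queryPoint D (stepSize D N) x₀ Δ₀ (fun j => g j ω)
        (fun j => n j ω) (fun j => s j ω) (k * N + j + 1)) i| ∂μ ≤
      K * (3 * D * Real.sqrt N * ∑ i, L i) + (f x₀ - ⨅ x, f x) := by
  have hblock : ∀ k ∈ Finset.range K, ∀ i ∈ Finset.univ, _ := fun k hk i _ =>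
    hrun.block_gradient_le hlip hD hΔ₀ hN (a := k * N)
      (by rw [← Nat.succ_mul]; exact Nat.mul_le_mul_right N (Finset.mem_range.1 hk)) i
  have hsum := Finset.sum_le_sum fun k hk => Finset.sum_le_sum (hblock k hk)
  simp only [← Finset.mul_sum, Finset.sum_sub_distrib, Finset.sum_const, Finset.card_range,
    nsmul_eq_mul] at hsum
  refine hsum.trans (le_of_eq_of_le ?_ (add_le_add_right (hrun.neg_sum_integral_inner_le
    (stepSize_zero D N) hlip hD.le hΔ₀ hwell hbdd) _))
  rw [sum_range_mul_eq_sum_sum, sub_eq_add_neg]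
  congr 1
  · ring
  · exact congrArg _ (Finset.sum_congr rfl fun k _ => Finset.sum_comm)

end IsRun
end Blocks

/-! ### Outer expectation and the random output -/

section Output

variable {Ω : Type*} [MeasurableSpace Ω] {μ : Measure Ω}

theorem outerExpectation_le_lintegral {F Φ : Ω → ℝ≥0∞} (hΦ : Measurable Φ) (h : F ≤ᵐ[μ] Φ) :
    outerExpectation μ F ≤ ∫⁻ ω, Φ ω ∂μ := by
  set A := toMeasurable μ {ω | ¬ F ω ≤ Φ ω} with hA
  have hA0 : μ A = 0 := by rw [hA, measure_toMeasurable]; exact h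
  have hAm : MeasurableSet A := measurableSet_toMeasurable _ _
  -- The exceptional null set is covered by a measurable one, where the majorant is infinite.
  refine iInf_le_of_le (fun ω => Φ ω + A.indicator (fun _ => ⊤) ω) (iInf_le_of_le
    (hΦ.add (measurable_const.indicator hAm)) (iInf_le_of_le (fun ω => ?_) ?_))
  · by_cases hω : F ω ≤ Φ ω
    · exact hω.trans le_self_add
    · have hωA : ω ∈ A := subset_toMeasurable μ _ (show ω ∈ {ω | ¬F ω ≤ Φ ω} from hω)
      simp [hωA]
  · rw [lintegral_add_left hΦ, lintegral_indicator_const hAm, hA0, mul_zero, add_zero]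

/-- Selecting one of `F 1, …, F K` by an independent uniform index averages the expectations. -/
theorem integral_uniform_index {Ω : Type*} {m mΩ : MeasurableSpace Ω} {μ : Measure Ω}
    [IsProbabilityMeasure μ] (hm : m ≤ mΩ) {K : ℕ} {κ : Ω → ℕ} (hκ : Measurable κ)
    (hunif : pdf.IsUniform κ (Set.Icc 1 K) μ Measure.count)
    (hindep : Indep (MeasurableSpace.comap κ inferInstance) m μ) {F : ℕ → Ω → ℝ}
    (hF : ∀ k ∈ Finset.Icc 1 K, Measurable[m] (F k))
    (hFint : ∀ k ∈ Finset.Icc 1 K, Integrable (F k) μ) :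
    ∫ ω, ∑ k ∈ Finset.Icc 1 K, F k ω * ({k} : Set ℕ).indicator 1 (κ ω) ∂μ
      = (K : ℝ)⁻¹ * ∑ k ∈ Finset.Icc 1 K, ∫ ω, F k ω ∂μ := by
  have hint : ∀ k ∈ Finset.Icc 1 K,
      Integrable (fun ω => F k ω * ({k} : Set ℕ).indicator 1 (κ ω)) μ := fun k hk => by
    refine (hFint k hk).mul_bdd (c := 1) ?_ (Filter.Eventually.of_forall fun ω => ?_)
    · exact ((measurable_one.indicator (measurableSet_singleton k)).comp hκ).aestronglyMeasurable
    · by_cases h : κ ω ∈ ({k} : Set ℕ) <;> simp [h]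
  rw [integral_finsetSum _ hint, Finset.mul_sum]
  refine Finset.sum_congr rfl fun k hk => ?_
  have hmass : (μ.map κ).real {k} = (K : ℝ)⁻¹ := by
    rw [show μ.map κ = _ from hunif, measureReal_def, cond_apply measurableSet_Icc,
      Set.inter_singleton_of_mem (by simpa using hk), Measure.count_singleton, mul_one,
      ← Finset.coe_Icc, Measure.count_apply_finset]
    simp
  have hφ : Measurable fun z : ℝ × ℕ => z.1 * ({k} : Set ℕ).indicator 1 z.2 :=
    measurable_fst.mul ((measurable_one.indicator (measurableSet_singleton k)).comp measurable_snd)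
  rw [(integral_comp_indep hm (hF k hk) hκ hindep hφ (hint k hk)).2]
  simp only [integral_const_mul, integral_indicator_one (measurableSet_singleton k), hmass,
    integral_mul_const]
  ring

end Output

/-! ### The choice of the parameters -/

section Parameters

/-- The two conditions say that the arguments of the ceilings are at least `1 / 2`, so that rounding
up costs at most a factor of `3`. -/
theorem step_count_bound {lam ε δ Δf : ℝ} {K N : ℕ} (hε : 0 < ε) (hδ : 0 < δ) (hΔf : 0 < Δf)
    (hK : K = ⌈3 * Δf / (ε * δ)⌉₊) (hN : N = ⌈81 * lam ^ 2 / (4 * ε ^ 2)⌉₊)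
    (h1 : ε * δ ≤ 6 * Δf) (h2 : 2 * ε ^ 2 ≤ 81 * lam ^ 2) :
    ((K * N : ℕ) : ℝ) ≤ 1323 * Δf * lam ^ 2 * δ⁻¹ * (ε ^ 3)⁻¹ := by
  -- `⌈x⌉ < x + 1 ≤ 3 x`
  have hceil : ∀ x : ℝ, 1 / 2 ≤ x → (⌈x⌉₊ : ℝ) ≤ 3 * x := fun x hx => by
    have := Nat.ceil_lt_add_one (by linarith : 0 ≤ x)
    linarith
  have hK' : (K : ℝ) ≤ 3 * (3 * Δf / (ε * δ)) := by
    rw [hK]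
    refine hceil _ ?_
    rw [div_le_div_iff₀ two_pos (by positivity)]
    linarith
  have hN' : (N : ℝ) ≤ 3 * (81 * lam ^ 2 / (4 * ε ^ 2)) := by
    rw [hN]
    refine hceil _ ?_
    rw [div_le_div_iff₀ two_pos (by positivity)]
    linarith
  have h0 : 0 ≤ Δf * lam ^ 2 * δ⁻¹ * (ε ^ 3)⁻¹ := by positivity
  push_cast
  calc (K : ℝ) * N ≤ 3 * (3 * Δf / (ε * δ)) * (3 * (81 * lam ^ 2 / (4 * ε ^ 2))) :=
        mul_le_mul hK' hN' (Nat.cast_nonneg _) (by positivity)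
    _ = 2187 / 4 * (Δf * lam ^ 2 * δ⁻¹ * (ε ^ 3)⁻¹) := by field_simp; ring
    _ ≤ 1323 * (Δf * lam ^ 2 * δ⁻¹ * (ε ^ 3)⁻¹) := by gcongr; norm_num
    _ = _ := by ring

/-- With the prescribed `K` and `N`, the descent term is at most `ε / 3` and the regret and noise
terms are at most `2 ε / 3`. -/
theorem error_bound {lam ε δ Δf D gap Q : ℝ} {K N : ℕ} (hε : 0 < ε) (hδ : 0 < δ)
    (hlam : 0 < lam) (hK0 : 0 < K) (hN0 : 0 < N) (hK : 3 * Δf / (ε * δ) ≤ K)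
    (hN : 81 * lam ^ 2 / (4 * ε ^ 2) ≤ N) (hD : D = δ / N) (hgap : gap ≤ Δf)
    (hQ : D * Q ≤ K * (3 * D * Real.sqrt N * lam) + gap) :
    (K : ℝ)⁻¹ * ((N : ℝ)⁻¹ * Q) ≤ ε := by
  have hKr : (0 : ℝ) < K := by exact_mod_cast hK0
  have hNr : (0 : ℝ) < N := by exact_mod_cast hN0
  have hD0 : 0 < D := hD ▸ div_pos hδ hNr
  have hsqrt : 0 < Real.sqrt N := Real.sqrt_pos.2 hNr
  have h1 : Δf / (K * δ) ≤ ε / 3 := by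
    rw [div_le_iff₀ (by positivity)] at hK ⊢
    linarith
  have h2 : 9 * lam / (2 * ε) ≤ Real.sqrt N := by
    refine Real.le_sqrt_of_sq_le (le_trans (le_of_eq ?_) hN)
    field_simp
    ring
  have h3 : 3 * lam / Real.sqrt N ≤ 2 * ε / 3 := by
    rw [div_le_iff₀ (by positivity)] at h2 ⊢
    linarith
  have h4 : (K : ℝ)⁻¹ * ((N : ℝ)⁻¹ * Q) = D * Q / (K * δ) := by
    rw [hD]; field_simp
  have h5 : (K * (3 * D * Real.sqrt N * lam) + gap) / (K * δ)
      = 3 * lam / Real.sqrt N + gap / (K * δ) := by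
    have : (N : ℝ) = Real.sqrt N * Real.sqrt N := (Real.mul_self_sqrt hNr.le).symm
    rw [add_div]
    congr 1
    rw [hD, div_eq_div_iff (by positivity) (by positivity)]
    field_simp
    rw [sq, ← this]
  calc _ = D * Q / (K * δ) := h4
    _ ≤ (K * (3 * D * Real.sqrt N * lam) + gap) / (K * δ) := by gcongr
    _ = 3 * lam / Real.sqrt N + gap / (K * δ) := h5
    _ ≤ 2 * ε / 3 + Δf / (K * δ) := by gcongr
    _ ≤ ε := by linarith

end Parameters

end StoSign

open StoSign

theorem mainTheorem6 {Ω : Type*} [MeasurableSpace Ω] (μ : Measure Ω) [IsProbabilityMeasure μ]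
    {d : ℕ} (f : EuclideanSpace ℝ (Fin d) → ℝ) (L : Fin d → ℝ) (ε δ Δf D : ℝ) (K N : ℕ)
    (x₀ Δ₀ : EuclideanSpace ℝ (Fin d))
    (g : ℕ → Ω → EuclideanSpace ℝ (Fin d)) (s : ℕ → Ω → ℝ) (n : ℕ → Ω → Fin d → ℝ)
    (κ : Ω → ℕ)
    (hε : 0 < ε) (hδ : 0 < δ) (hΔf : 0 < Δf) (hL : 0 < StoSign.lpNorm 1 L)
    -- the parameters
    (hK : K = ⌈3 * Δf / (ε * δ)⌉₊)
    (hN : N = ⌈81 * StoSign.lpNorm 1 L ^ 2 / (4 * ε ^ 2)⌉₊)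
    (hD : D = δ / N)
    (hΔ₀ : Δ₀ ∈ StoSign.lpBall ⊤ 0 D)
    -- the assumptions on the objective
    (hwell : StoSign.WellBehaved f)
    (hbdd : BddBelow (Set.range f))
    (hgap : f x₀ - ⨅ x, f x ≤ Δf)
    -- the run of the algorithm, its stochastic gradients, and its random output index
    (hrun : StoSign.IsRun μ f D (StoSign.stepSize D N) x₀ Δ₀ (K * N) g s n)
    (hlip : StoSign.CoordLipschitz μ (K * N) g L)
    (hκ_meas : Measurable κ)
    (hκ_unif : pdf.IsUniform κ (Set.Icc 1 K) μ Measure.count)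
    (hκ_indep : Indep (MeasurableSpace.comap κ inferInstance)
      (StoSign.history g s n (K * N) (K * N) (K * N)) μ) :
    StoSign.outerExpectation μ (fun ω => ENNReal.ofReal
        (StoSign.goldsteinMeasure 1 ⊤ f δ
          (StoSign.blockAverage N
            (StoSign.queryPoint D (StoSign.stepSize D N) x₀ Δ₀
              (fun j => g j ω) (fun j => n j ω) (fun j => s j ω))
            (κ ω)))) ≤ ENNReal.ofReal ε ∧
    (ε * δ ≤ 6 * Δf → 2 * ε ^ 2 ≤ 81 * StoSign.lpNorm 1 L ^ 2 →
      ((K * N : ℕ) : ℝ) ≤ 1323 * Δf * StoSign.lpNorm 1 L ^ 2 * δ⁻¹ * (ε ^ 3)⁻¹) := by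
  refine ⟨?_, fun h1 h2 => step_count_bound hε hδ hΔf hK hN h1 h2⟩
  -- `‖L‖₁ > 0` excludes dimension zero
  have hd : NeZero d := ⟨by
    rintro rfl
    simp [lpNorm_one] at hL⟩
  have hK0 : 0 < K := hK ▸ Nat.ceil_pos.2 (by positivity)
  have hN0 : 0 < N := hN ▸ Nat.ceil_pos.2 (by positivity)
  have hNr : (0 : ℝ) < N := by exact_mod_cast hN0
  have hD0 : 0 < D := hD ▸ div_pos hδ hNr
  have hND : N * D = δ := by rw [hD, mul_div_cancel₀ _ hNr.ne']
  have hLsum : lpNorm 1 L = ∑ i, L i := by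
    rw [lpNorm_one]
    exact Finset.sum_congr rfl fun i _ => abs_of_nonneg (hlip.nonneg i)
  set w : Ω → ℕ → EuclideanSpace ℝ (Fin d) := fun ω => queryPoint D (stepSize D N) x₀ Δ₀
    (fun j => g j ω) (fun j => n j ω) (fun j => s j ω)
  set F : ℕ → Ω → ℝ := fun k ω =>
    ∑ i, |(N : ℝ)⁻¹ * ∑ j ∈ Finset.range N, gradient f (w ω ((k - 1) * N + j + 1)) i|
  have hindex : ∀ k ∈ Finset.Icc 1 K, ∀ j < N, (k - 1) * N + j < K * N := by
    intro k hk j hj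
    obtain ⟨h1, h2⟩ := Finset.mem_Icc.1 hk
    calc (k - 1) * N + j < (k - 1) * N + N := by omega
      _ = k * N := by rw [← Nat.succ_mul, Nat.succ_eq_add_one, Nat.sub_add_cancel h1]
      _ ≤ K * N := Nat.mul_le_mul_right N h2
  have hFmeas : ∀ k ∈ Finset.Icc 1 K, Measurable[history g s n (K * N) (K * N) (K * N)] (F k) := by
    intro k hk
    refine Finset.measurable_fun_sum _ fun i _ => ?_
    have hS : Measurable[history g s n (K * N) (K * N) (K * N)] fun ω =>
        ∑ j ∈ Finset.range N, gradient f (w ω ((k - 1) * N + j + 1)) i :=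
      Finset.measurable_fun_sum _ fun j hj => by
        have := hindex k hk j (Finset.mem_range.1 hj)
        exact measurable_gradient_queryPoint_history (stepSize_zero D N) (by omega) (by omega)
          (by omega) i
    exact continuous_abs.measurable.comp (hS.const_mul _)
  have hFint : ∀ k ∈ Finset.Icc 1 K, Integrable (F k) μ := fun k hk =>
    integrable_finsetSum _ fun i _ => ((integrable_finsetSum _ fun j hj =>
      (hrun.memLp_gradient_queryPoint hlip (hindex k hk j (Finset.mem_range.1 hj)) i).integrable
        one_le_two).const_mul _).abs
  have hle := hrun.history_le (le_refl (K * N)) (le_refl (K * N)) (le_refl (K * N))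
  set Φ : Ω → ℝ := fun ω => ∑ k ∈ Finset.Icc 1 K, F k ω * ({k} : Set ℕ).indicator 1 (κ ω) with hΦ
  have hind : ∀ k, Measurable fun ω => ({k} : Set ℕ).indicator (1 : ℕ → ℝ) (κ ω) := fun k =>
    (measurable_one.indicator (measurableSet_singleton k)).comp hκ_meas
  have hΦmeas : Measurable Φ := Finset.measurable_fun_sum _ fun k hk =>
    ((hFmeas k hk).mono hle le_rfl).mul (hind k)
  have hF0 : ∀ k ω, 0 ≤ F k ω := fun k ω => Finset.sum_nonneg fun i _ => abs_nonneg _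
  have hΦ0 : ∀ ω, 0 ≤ Φ ω := fun ω => Finset.sum_nonneg fun k _ =>
    mul_nonneg (hF0 k ω) (Set.indicator_nonneg (fun _ _ => zero_le_one) _)
  have hΦint : Integrable Φ μ := integrable_finsetSum _ fun k hk => by
    refine (hFint k hk).mul_bdd (c := 1) (hind k).aestronglyMeasurable
      (Filter.Eventually.of_forall fun ω => ?_)
    by_cases h : κ ω ∈ ({k} : Set ℕ) <;> simp [h]
  have hκ_mem : ∀ᵐ ω ∂μ, κ ω ∈ Set.Icc 1 K := by
    refine ae_of_ae_map hκ_meas.aemeasurable ?_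
    rw [show μ.map κ = _ from hκ_unif]
    exact ae_cond_mem measurableSet_Icc
  have hs_mem : ∀ᵐ ω ∂μ, ∀ t < K * N, s (t + 1) ω ∈ Set.Icc (0 : ℝ) 1 := by
    refine ae_all_iff.2 fun t => ?_
    by_cases ht : t < K * N
    · have h1 : ∀ᵐ ω ∂μ, s (t + 1) ω ∈ Set.Icc (0 : ℝ) 1 := by
        refine ae_of_ae_map (hrun.measurable_s t ht).aemeasurable ?_
        rw [show μ.map (s (t + 1)) = _ from hrun.scaling_uniform t ht]
        exact ae_cond_mem measurableSet_Icc
      exact h1.mono fun ω h _ => h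
    · exact Filter.Eventually.of_forall fun ω h => absurd h ht
  have hbound : ∀ᵐ ω ∂μ, ENNReal.ofReal (goldsteinMeasure 1 ⊤ f δ (blockAverage N (w ω) (κ ω)))
      ≤ ENNReal.ofReal (Φ ω) := by
    filter_upwards [hκ_mem, hs_mem] with ω hκω hsω
    have hκω' : κ ω ∈ Finset.Icc 1 K := Finset.mem_Icc.2 hκω
    have hΦω : Φ ω = F (κ ω) ω := by
      simp only [hΦ]
      rw [Finset.sum_eq_single_of_mem _ hκω']
      · simp
      · intro k _ hk
        simp [hk.symm]
    rw [hΦω]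
    refine ENNReal.ofReal_le_ofReal ?_
    refine goldsteinMeasure_one_top_le hwell hN0 (fun j => w ω ((κ ω - 1) * N + j + 1))
      (Finset.range N) (Finset.card_range N) _ ?_ fun j hj i => ?_
    · rw [blockAverage, sum_Icc_one_eq_sum_range]
      rfl
    · exact abs_queryPoint_sub_blockAverage_lt hD0.le hΔ₀ hδ hND
        (fun l hl => hsω _ (hindex _ hκω' l hl)) (Finset.mem_range.1 hj) i
  refine (outerExpectation_le_lintegral hΦmeas.ennreal_ofReal hbound).trans ?_
  rw [← ofReal_integral_eq_lintegral_ofReal hΦint (Filter.Eventually.of_forall hΦ0)]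
  refine ENNReal.ofReal_le_ofReal ?_
  rw [integral_uniform_index hle hκ_meas hκ_unif hκ_indep hFmeas hFint, sum_Icc_one_eq_sum_range]
  have hsum := hrun.sum_block_gradient_le hlip hD0 hΔ₀ hN0 hwell hbdd
  rw [← hLsum] at hsum
  refine le_of_eq_of_le ?_ (error_bound hε hδ hL hK0 hN0 (hK ▸ Nat.le_ceil _) (hN ▸ Nat.le_ceil _)
    hD hgap hsum)
  congr 1
  rw [Finset.mul_sum]
  refine Finset.sum_congr rfl fun k hk => ?_
  rw [Finset.mul_sum, integral_finsetSum]
  · refine Finset.sum_congr rfl fun i _ => ?_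
    simp only [abs_mul, abs_of_pos (inv_pos.2 hNr), integral_const_mul, Nat.add_sub_cancel]
    rfl
  · exact fun i _ => ((integrable_finsetSum _ fun j hj => (hrun.memLp_gradient_queryPoint hlip
      (hindex (k + 1) (Finset.mem_Icc.2 ⟨by omega, Finset.mem_range.1 hk⟩) j
        (Finset.mem_range.1 hj)) i).integrable one_le_two).const_mul _).abs
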